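/- \textbf{Setting.} Let $d,p\ge 1$, $\Theta=[\theta_{inf},\theta_{sup}]^p\subset\mathbb{R}^p$, and let $\theta_0$ satisfy $\theta_{inf}<(\theta_0)_i<\theta_{sup}$ for all $i$. Let $\{K_\theta,\theta\in\Theta\}$ be functions $\mathbb{R}^d\to\mathbb{R}$ such that: (i) each $K_\theta$ is a stationary covariance function, i.e. $(s,t)\mapsto K_\theta(s-t)$ is symmetric and positive semidefinite; (ii) $K_\theta(t)$ is three times differentiable with respect to $\theta\in\Theta$, and for all $0\le q\le 3$ and $i_1,\dots,i_q\in\{1,\dots,p\}$ there is $C_{i_1,\dots,i_q}<\infty$ such that $\left|\frac{\partial}{\partial\theta_{i_1}}\cdots\frac{\partial}{\partial\theta_{i_q}}K_\theta(t)\right|\le \frac{C_{i_1,\dots,i_q}}{1+|t|^{d+1}}$ for all $\theta\in\Theta$, $t\in\mathbb{R}^d$, where $|t|$ is the Euclidean norm; (iii) with $\hat K_\theta(f)=\frac{1}{(2\pi)^d}\int_{\mathbb{R}^d}K_\theta(t)e^{-\mathrm{i}f\cdot t}\,dt$, one has $K_\theta(t)=\int_{\mathbb{R}^d}\hat K_\theta(f)e^{\mathrm{i}f\cdot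 t}\,df$ for all $\theta\in\Theta$ and $t\in\mathbb{R}^d$, and $(f,\theta)\mapsto\hat K_\theta(f)$ is real-valued, continuous and (strictly) positive on $\mathbb{R}^d\times\Theta$; (iv) for every $\theta\in\Theta$ and $1\le i\le p$, $t\mapsto\frac{\partial}{\partial\theta_i}K_\theta(t)$ is continuous. Let $(v_i)_{i\ge1}$ be points of $\{1,2,\dots\}^d$ with $\{v_i:1\le i\le N^d\}=\{1,\dots,N\}^d$ for all $N\ge1$, and let $\epsilon\in[0,\frac12)$. Let $(X_i)_{i\ge1}$ be i.i.d. random vectors on a probability space $(\Omega_X,\mathcal F_X,P_X)$, whose common law is symmetric (invariant under $x\mapsto -x$), has support $S_X\subset[-1,1]^d$, and has a probability density function that is positive on $S_X$. Let $Y=(Y(t))_{t\in\mathbb{R}^d}$ be a centered Gaussian process on a probability space $(\Omega_Y,\mathcal F_Y,P_Y)$ with $\mathrm{cov}(Y(s),Y(t))=K_{\theta_0}(s-t)$ and with almost surely continuous trajectories. All probabilities and expectations below are taken on the product space $(\Omega_X\times\Omega_Y,\ \mathcal F_X\otimes\mathcal F_Y,\ \mathbb P=P_X\times P_Y)$; in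 particular $X$ and $Y$ are independent. For $n\ge1$ let $y_i=Y(v_i+\epsilon X_i)$, $1\le i\le n$, and let $$\hat Y_\theta(t)=r_\theta(t)^{\top}R_\theta^{-1}y,\qquad (r_\theta(t))_j=K_\theta(v_j+\epsilon X_j-t),\qquad (R_\theta)_{i,j}=K_\theta(v_i-v_j+\epsilon(X_i-X_j))$$ be the Kriging prediction of $Y(t)$ under the covariance function $K_\theta$ given $y=(y_1,\dots,y_n)^{\top}$. Let $N_{1,n}$ be the integer with $N_{1,n}^d\le n<(N_{1,n}+1)^d$, and let $$E_{\epsilon,\theta}=E_{\epsilon,\theta}^{(n)}:=\frac{1}{N_{1,n}^d}\int_{[0,N_{1,n}]^d}\left(\hat Y_\theta(t)-Y(t)\right)^2dt .$$ \textbf{Proposition.} (1) For every sequence $\hat\theta=\hat\theta_n$ of $\Theta$-valued random variables that converges to $\theta_0$ in probability (in particular, for every consistent $\Theta$-valued estimator of $\theta_0$), $|E_{\epsilon,\theta_0}-E_{\epsilon,\hat\theta}|\to0$ in probability as $n\to\infty$. (2) There exists a constant $A>0$, not depending on $n$, such that for all $n\ge1$ the random variable $E_{\epsilon,\theta_0}$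 is integrable and $\mathbb{E}(E_{\epsilon,\theta_0})\ge A$. -/

import Mathlib

open MeasureTheory ProbabilityTheory Filter Topology Matrix

noncomputable section

namespace Kriging

/-- The index space `ℝ^d`, with the Euclidean norm and Lebesgue measure. -/
abbrev Space (d : ℕ) : Type := EuclideanSpace ℝ (Fin d)

/-- The parameter set `Θ = [a, b]^p`. -/
def paramSet (p : ℕ) (a b : ℝ) : Set (Fin p → ℝ) := {θ | ∀ i, θ i ∈ Set.Icc a b}

/-- The partial derivative `∂g/∂θ_i` at `θ` of a function `g` on `[a, b]^p` (one-sided on the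
faces of the cube). -/
def partialDeriv {p : ℕ} (a b : ℝ) (i : Fin p) (g : (Fin p → ℝ) → ℝ) (θ : Fin p → ℝ) : ℝ :=
  derivWithin (fun s => g (Function.update θ i s)) (Set.Icc a b) (θ i)

/-- The iterated partial derivative `∂/∂θ_{i₁} ⋯ ∂/∂θ_{i_q} g` for the list `[i₁, …, i_q]`. -/
def iterPartial {p : ℕ} (a b : ℝ) :
    List (Fin p) → ((Fin p → ℝ) → ℝ) → ((Fin p → ℝ) → ℝ)
  | [], g => g
  | i :: I, g => partialDeriv a b i (iterPartial a b I g)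

/-- The Fourier transform `ĥ(f) = (2π)^{-d} ∫ h(t) e^{-i f·t} dt`. -/
def fourierTransform {d : ℕ} (h : Space d → ℝ) (f : Space d) : ℂ :=
  (1 / (2 * (Real.pi : ℂ)) ^ d) *
    ∫ t : Space d, (h t : ℂ) * Complex.exp (-(Complex.I * ((inner ℝ f t : ℝ) : ℂ)))

/-- `k` is a stationary covariance function: `(s, t) ↦ k (s - t)` is symmetric and positive
semidefinite. -/
structure IsStationaryCovariance {d : ℕ} (k : Space d → ℝ) : Prop where
  even : ∀ t, k (-t) = k t
  nonneg : ∀ (m : ℕ) (c : Fin m → ℝ) (t : Fin m → Space d),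
    0 ≤ ∑ i, ∑ j, c i * c j * k (t i - t j)

/-- The regularity condition on the parametric model `{K_θ, θ ∈ [a, b]^p}`.
In `inversion` and `spectral_pos` the integrals are never junk values: positivity of the
transform forces `K_θ` to be integrable, and then inversion together with positivity forces the
transform to be integrable. -/
structure RegularModel {d p : ℕ} (a b : ℝ) (K : (Fin p → ℝ) → Space d → ℝ) : Prop where
  /-- every `K_θ` is a stationary covariance function -/
  stationary : ∀ θ ∈ paramSet p a b, IsStationaryCovariance (K θ)
  /-- `K_θ(t)` is three times (partially) differentiable with respect to `θ` on `[a, b]^p` -/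
  differentiable : ∀ I : List (Fin p), I.length < 3 → ∀ i : Fin p, ∀ θ ∈ paramSet p a b,
    ∀ t : Space d, DifferentiableWithinAt ℝ
      (fun s => iterPartial a b I (fun η => K η t) (Function.update θ i s)) (Set.Icc a b) (θ i)
  /-- the partial derivatives of order `0, …, 3` decay like `1 / (1 + |t|^{d+1})`, uniformly
  in `θ` -/
  bound : ∀ I : List (Fin p), I.length ≤ 3 → ∃ C : ℝ, ∀ θ ∈ paramSet p a b, ∀ t : Space d,
    |iterPartial a b I (fun η => K η t) θ| ≤ C / (1 + ‖t‖ ^ (d + 1))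
  /-- `K_θ` is the inverse Fourier transform of its Fourier transform -/
  inversion : ∀ θ ∈ paramSet p a b, ∀ t : Space d,
    (K θ t : ℂ) = ∫ f : Space d,
      fourierTransform (K θ) f * Complex.exp (Complex.I * ((inner ℝ f t : ℝ) : ℂ))
  /-- the Fourier transform is real and positive -/
  spectral_pos : ∀ θ ∈ paramSet p a b, ∀ f : Space d,
    (fourierTransform (K θ) f).im = 0 ∧ 0 < (fourierTransform (K θ) f).re
  /-- the Fourier transform is jointly continuous in frequency and parameter -/
  spectral_continuous : ContinuousOn
    (fun q : Space d × (Fin p → ℝ) => fourierTransform (K q.2) q.1)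
    (Set.univ ×ˢ paramSet p a b)

/-- `v` enumerates the positive integer points cube after cube: its first `N ^ d` terms make up
`{1, …, N}^d`, for every `N ≥ 1`. (Sequences are indexed from `0`.) -/
def IsGridEnumeration {d : ℕ} (v : ℕ → Fin d → ℕ) : Prop :=
  ∀ N : ℕ, 1 ≤ N → v '' {i | i < N ^ d} = {u | ∀ k, 1 ≤ u k ∧ u k ≤ N}

/-- Admissible perturbation laws: a symmetric probability distribution with support contained in
`[-1, 1]^d` and with a probability density that is positive on the support. -/
structure IsPerturbationLaw {d : ℕ} (L : Measure (Space d)) : Prop where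
  isProbabilityMeasure : IsProbabilityMeasure L
  symmetric : L.map (fun x => -x) = L
  support_subset : L.support ⊆ {x | ∀ k, x k ∈ Set.Icc (-1 : ℝ) 1}
  density : ∃ g : Space d → ENNReal, Measurable g ∧ (∀ x ∈ L.support, 0 < g x) ∧
    L = (volume.restrict L.support).withDensity g

/-- `Y` is a centered Gaussian process on `ℝ^d` with covariance `cov(Y(s), Y(t)) = k(s - t)`. -/
structure IsCenteredGaussianProcess {d : ℕ} {Ω : Type*} [MeasurableSpace Ω]
    (Y : Space d → Ω → ℝ) (k : Space d → ℝ) (P : Measure Ω) : Prop where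
  measurable : ∀ t, Measurable (Y t)
  gaussian : IsGaussianProcess Y P
  mean_zero : ∀ t, ∫ ω, Y t ω ∂P = 0
  cov_eq : ∀ s t, covariance (Y s) (Y t) P = k (s - t)

/-- The covariance matrix `(k(s_i - s_j))_{i,j}` of the observations at `s_1, …, s_n`. -/
def covMatrix {d n : ℕ} (k : Space d → ℝ) (s : Fin n → Space d) : Matrix (Fin n) (Fin n) ℝ :=
  Matrix.of fun i j => k (s i - s j)

/-- The Kriging prediction at `t` under the (centered Gaussian) covariance function `k`, given
the observations `y_1, …, y_n` at `s_1, …, s_n`: `r(t)ᵀ R⁻¹ y` with `r(t)_j = k(s_j - t)` and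
`R_{i,j} = k(s_i - s_j)`. -/
def predictor {d n : ℕ} (k : Space d → ℝ) (s : Fin n → Space d) (y : Fin n → ℝ)
    (t : Space d) : ℝ :=
  (fun j => k (s j - t)) ⬝ᵥ ((covMatrix k s)⁻¹ *ᵥ y)

/-- The observation points `v_i + ε x_i`, `i < n`. -/
def obsPoints {d : ℕ} (v : ℕ → Fin d → ℕ) (ε : ℝ) (x : ℕ → Space d) (n : ℕ) :
    Fin n → Space d :=
  fun i => WithLp.toLp 2 (fun k => (v i k : ℝ)) + ε • x i

/-- The cube `[0, N]^d`. -/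
def cube (d N : ℕ) : Set (Space d) := {t | ∀ k, t k ∈ Set.Icc (0 : ℝ) N}

/-- The averaged integrated squared prediction error
`N^{-d} ∫_{[0,N]^d} (Ŷ(t) - Y(t))² dt` of the Kriging prediction under the covariance function
`k`, for the trajectory `path` observed at the first `n` points `v_i + ε x_i`. -/
def predError {d : ℕ} (v : ℕ → Fin d → ℕ) (ε : ℝ) (n N : ℕ) (k : Space d → ℝ)
    (x : ℕ → Space d) (path : Space d → ℝ) : ℝ :=
  (1 / (N : ℝ) ^ d) * ∫ t in cube d N,
    (predictor k (obsPoints v ε x n) (fun i => path (obsPoints v ε x n i)) t - path t) ^ 2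

end Kriging

end

noncomputable section

namespace Kriging

/-! The proof rests on deterministic estimates for one fixed continuous trajectory, valid for every
configuration of points pairwise at distance at least `δ`. Their constants depend neither on the
number of points, nor on their position, nor on `θ ∈ Θ`. Since `ε < 1/2`, the perturbed grid is
almost surely such a configuration.

Two facts carry these estimates. The kernels, and their increments in `θ` divided by the size of the
parameter step, are dominated by an integrable decay, so sums over separated points are bounded and
Schur tests apply. Moreover, the smallest eigenvalue of `R_θ` stays above some `c > 0`
(`RegularModel.exists_quadraticForm_ge`): on a large ball the spectral density dominates a multiple
of a dilated bump, and the matrix that this bump generates is diagonally dominant once the dilation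
is large. Hence the Kriging predictor is bounded and Lipschitz in `θ` in `L²`, which yields `|E_θ -
E_η| ≤ A ‖θ - η‖ · energy` (`RegularModel.exists_predError_bounds`). This holds for all parameters
at once, so an estimator computed from the data may be inserted. The energy has bounded mean, and
Markov's inequality gives (1).

For (2), a point `t` with coordinates close to half-integers remains separated from the
observations. The error at `t` is a linear combination of values of `Y` with coefficient `-1` at
`Y(t)`, so its variance is at least `c`. Such points fill the fixed fraction `(2 * gap ε) ^ d` of
the cube. -/

/-! ### Summable decay over separated points -/

/-- The reference decay `(1 + |t|)^{-(d+1)}`. -/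
def decay {d : ℕ} (t : Space d) : ℝ := ((1 + ‖t‖) ^ (d + 1))⁻¹

lemma decay_pos {d : ℕ} (t : Space d) : 0 < decay t := by unfold decay; positivity

lemma decay_neg {d : ℕ} (t : Space d) : decay (-t) = decay t := by simp [decay]

lemma decay_sub_comm {d : ℕ} (s t : Space d) : decay (s - t) = decay (t - s) := by
  rw [← decay_neg, neg_sub]

lemma integrable_decay (d : ℕ) : Integrable (decay (d := d)) := by
  have h := integrable_one_add_norm (E := Space d) (μ := volume) (r := (d : ℝ) + 1) (by simp)
  refine h.congr (.of_forall fun x => ?_)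
  have : (0 : ℝ) < 1 + ‖x‖ := by positivity
  simp only [decay]
  rw [Real.rpow_neg this.le]
  norm_cast

lemma inv_one_add_norm_pow_le {d : ℕ} (t : Space d) :
    1 / (1 + ‖t‖ ^ (d + 1)) ≤ 2 ^ d * decay t := by
  have h := add_pow_le (zero_le_one (α := ℝ)) (norm_nonneg t) (d + 1)
  rw [one_pow, Nat.add_sub_cancel] at h
  unfold decay
  rw [← div_eq_mul_inv, div_le_div_iff₀ (by positivity) (by positivity)]
  linarith

/-- Since `1 + ‖u‖ ≤ (1 + r) (1 + ‖s‖)`, the decay changes by at most a constant factor over a ball;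
this permits comparing sums with integrals. -/
lemma decay_le_of_norm_sub_le {d : ℕ} {r : ℝ} {s u : Space d} (h : ‖s - u‖ ≤ r) :
    decay s ≤ (1 + r) ^ (d + 1) * decay u := by
  have hr : 0 ≤ r := (norm_nonneg _).trans h
  unfold decay
  rw [← div_eq_mul_inv, inv_eq_one_div, div_le_div_iff₀ (by positivity) (by positivity), one_mul,
    ← mul_pow]
  refine pow_le_pow_left₀ (by positivity) ?_ _
  have : ‖u‖ ≤ ‖s‖ + ‖s - u‖ := by
    have := norm_sub_le s (s - u); simpa using this
  nlinarith [norm_nonneg s]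

/-- The points `s i` are pairwise at distance at least `δ`. -/
def Separated {d : ℕ} {ι : Type} (δ : ℝ) (s : ι → Space d) : Prop :=
  ∀ i j, i ≠ j → δ ≤ ‖s i - s j‖

/-- The balls of radius `δ / 2` around the points are disjoint, and each term is at most a constant
times the integral of the decay over its ball. The same `S` bounds the integral because the Schur
test in `L²` has sums for rows and integrals for columns. -/
lemma exists_sum_decay_le (d : ℕ) {δ : ℝ} (hδ : 0 < δ) :
    ∃ S : ℝ, 0 < S ∧ (∫ t, decay (d := d) t) ≤ S ∧ ∀ (ι : Type) [Fintype ι] (s : ι → Space d),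
      Separated δ s → ∀ t, ∑ j, decay (s j - t) ≤ S := by
  set r := δ / 2
  have hr : 0 < r := by positivity
  set V := volume.real (Metric.ball (0 : Space d) r)
  have hV : 0 < V := by
    refine ENNReal.toReal_pos (Metric.measure_ball_pos _ _ hr).ne' measure_ball_lt_top.ne
  set J := ∫ t, decay (d := d) t
  have hJ : 0 ≤ J := integral_nonneg fun t => (decay_pos t).le
  -- The first term bounds the sums, `J` covers the integral, and 1 gives strict positivity.
  refine ⟨V⁻¹ * ((1 + r) ^ (d + 1) * J) + J + 1, by positivity, ?_, fun ι _ s hs t => ?_⟩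
  · have : 0 ≤ V⁻¹ * ((1 + r) ^ (d + 1) * J) := by positivity
    linarith
  have hint : Integrable (fun u : Space d => decay (u - t)) := (integrable_decay d).comp_sub_right t
  have hdisj : Pairwise (Function.onFun Disjoint fun j => Metric.ball (s j) r) := by
    intro i j hij
    refine Metric.ball_disjoint_ball ?_
    rw [dist_eq_norm]
    linarith [hs i j hij, show r = δ / 2 from rfl]
  have hone : ∀ j, V * decay (s j - t) ≤
      (1 + r) ^ (d + 1) * ∫ u in Metric.ball (s j) r, decay (u - t) := by
    intro j
    have h1 : V * decay (s j - t) = ∫ _u in Metric.ball (s j) r, decay (s j - t) := by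
      rw [setIntegral_const, smul_eq_mul]
      congr 1
      simp only [V, Measure.real]
      rw [Measure.addHaar_ball_center volume (s j) r]
    rw [h1, ← integral_const_mul]
    refine setIntegral_mono_on (integrableOn_const (by exact measure_ball_lt_top.ne))
      (hint.integrableOn.const_mul _) measurableSet_ball fun u hu => ?_
    refine decay_le_of_norm_sub_le ?_
    rw [sub_sub_sub_cancel_right, ← dist_eq_norm, dist_comm]
    exact (Metric.mem_ball.1 hu).le
  have hsum : V * ∑ j, decay (s j - t) ≤ (1 + r) ^ (d + 1) * J := by
    rw [Finset.mul_sum]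
    refine (Finset.sum_le_sum fun j _ => hone j).trans ?_
    rw [← Finset.mul_sum, ← integral_iUnion_fintype (fun _ => measurableSet_ball) hdisj
      fun _ => hint.integrableOn]
    gcongr
    refine (setIntegral_le_integral hint (.of_forall fun u => (decay_pos _).le)).trans ?_
    exact (integral_sub_right_eq_self (fun u => decay u) t).le
  have : ∑ j, decay (s j - t) ≤ V⁻¹ * ((1 + r) ^ (d + 1) * J) := by
    rw [inv_mul_eq_div, le_div_iff₀ hV, mul_comm]
    exact hsum
  linarith

/-! ### Schur tests -/

/-- Cauchy–Schwarz after splitting `|g j|` evenly between the two factors. -/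
lemma sum_mul_sq_le_of_sum_abs_le {ι : Type} [Fintype ι] {g b : ι → ℝ} {M : ℝ}
    (h : ∑ j, |g j| ≤ M) : (∑ j, b j * g j) ^ 2 ≤ M * ∑ j, b j ^ 2 * |g j| := by
  have hb : 0 ≤ ∑ j, b j ^ 2 * |g j| := Finset.sum_nonneg fun j _ => by positivity
  refine le_trans ?_ (mul_le_mul_of_nonneg_right h hb)
  refine Finset.sum_sq_le_sum_mul_sum_of_sq_le_mul _ (fun _ _ => abs_nonneg _)
    (fun _ _ => by positivity) fun j _ => ?_
  rw [mul_pow, ← sq_abs (g j)]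
  apply le_of_eq; ring

/-- Schur test for matrices. -/
lemma sum_sq_mulVec_le {ι : Type} [Fintype ι] {A : ι → ι → ℝ} {b : ι → ℝ} {M : ℝ}
    (hrow : ∀ i, ∑ j, |A i j| ≤ M) (hcol : ∀ j, ∑ i, |A i j| ≤ M) :
    ∑ i, (∑ j, b j * A i j) ^ 2 ≤ M ^ 2 * ∑ j, b j ^ 2 := by
  rcases isEmpty_or_nonempty ι with hι | ⟨⟨i₀⟩⟩
  · simp
  have hM : 0 ≤ M := (Finset.sum_nonneg fun j _ => abs_nonneg _).trans (hrow i₀)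
  calc ∑ i, (∑ j, b j * A i j) ^ 2 ≤ ∑ i, M * ∑ j, b j ^ 2 * |A i j| :=
        Finset.sum_le_sum fun i _ => sum_mul_sq_le_of_sum_abs_le (hrow i)
    _ = M * ∑ j, b j ^ 2 * ∑ i, |A i j| := by
        rw [← Finset.mul_sum, Finset.sum_comm]
        simp_rw [Finset.mul_sum]
    _ ≤ M * ∑ j, b j ^ 2 * M := by
        gcongr with j; exact hcol j
    _ = _ := by rw [← Finset.sum_mul]; ring

/-- Schur test for quadratic forms. -/
lemma abs_sum_sum_le {ι : Type} [Fintype ι] {A : ι → ι → ℝ} {b : ι → ℝ} {M : ℝ}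
    (hrow : ∀ i, ∑ j, |A i j| ≤ M) (hcol : ∀ j, ∑ i, |A i j| ≤ M) :
    |∑ i, ∑ j, b i * b j * A i j| ≤ M * ∑ j, b j ^ 2 := by
  calc |∑ i, ∑ j, b i * b j * A i j| ≤ ∑ i, ∑ j, |b i * b j * A i j| :=
        (Finset.abs_sum_le_sum_abs _ _).trans
          (Finset.sum_le_sum fun i _ => Finset.abs_sum_le_sum_abs _ _)
    _ ≤ ∑ i, ∑ j, (b i ^ 2 * |A i j| / 2 + b j ^ 2 * |A i j| / 2) := by
        refine Finset.sum_le_sum fun i _ => Finset.sum_le_sum fun j _ => ?_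
        rw [abs_mul, abs_mul]
        have : |b i| * |b j| ≤ (b i ^ 2 + b j ^ 2) / 2 := by
          nlinarith [sq_nonneg (|b i| - |b j|), sq_abs (b i), sq_abs (b j)]
        nlinarith [mul_le_mul_of_nonneg_right this (abs_nonneg (A i j))]
    _ = (∑ i, b i ^ 2 * ∑ j, |A i j|) / 2 + (∑ j, b j ^ 2 * ∑ i, |A i j|) / 2 := by
        simp_rw [Finset.sum_add_distrib]
        congr 1
        · simp_rw [Finset.mul_sum, Finset.sum_div]
        · rw [Finset.sum_comm]
          simp_rw [Finset.mul_sum, Finset.sum_div]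
    _ ≤ (∑ i, b i ^ 2 * M) / 2 + (∑ j, b j ^ 2 * M) / 2 := by
        gcongr with i _ j _
        · exact hrow i
        · exact hcol j
    _ = _ := by rw [← Finset.sum_mul]; ring

/-- Schur test for the synthesis operator `b ↦ ∑ b_j g_j` into `L²`. -/
lemma setIntegral_sq_sum_le {d : ℕ} {ι : Type} [Fintype ι] {g : ι → Space d → ℝ} {b : ι → ℝ}
    {M : ℝ} {D : Set (Space d)}
    (hg : ∀ j, Integrable (g j)) (hM : 0 ≤ M) (hrow : ∀ t, ∑ j, |g j t| ≤ M)
    (hcol : ∀ j, ∫ t, |g j t| ≤ M) :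
    ∫ t in D, (∑ j, b j * g j t) ^ 2 ≤ M ^ 2 * ∑ j, b j ^ 2 := by
  have hi : Integrable fun t => M * ∑ j, b j ^ 2 * |g j t| :=
    (integrable_finsetSum _ fun j _ => (hg j).abs.const_mul _).const_mul _
  calc ∫ t in D, (∑ j, b j * g j t) ^ 2 ≤ ∫ t in D, M * ∑ j, b j ^ 2 * |g j t| :=
        integral_mono_of_nonneg (.of_forall fun t => sq_nonneg _) hi.integrableOn
          (.of_forall fun t => sum_mul_sq_le_of_sum_abs_le (hrow t))
    _ ≤ ∫ t, M * ∑ j, b j ^ 2 * |g j t| :=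
        setIntegral_le_integral hi (.of_forall fun t =>
          mul_nonneg hM (Finset.sum_nonneg fun j _ => by positivity))
    _ = M * ∑ j, b j ^ 2 * ∫ t, |g j t| := by
        rw [integral_const_mul, integral_finsetSum _ fun j _ => (hg j).abs.const_mul _]
        simp_rw [integral_const_mul]
    _ ≤ M * ∑ j, b j ^ 2 * M := by
        gcongr with j; exact hcol j
    _ = _ := by rw [← Finset.sum_mul]; ring

/-! ### Spectral representation of the covariance -/

lemma integrable_mul_cos {d : ℕ} {q : Space d → ℝ} (hq : Integrable q) (t : Space d) :
    Integrable fun f => q f * Real.cos (inner ℝ f t) := by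
  refine hq.mul_bdd (c := 1) (by fun_prop) (.of_forall fun f => ?_)
  rw [Real.norm_eq_abs]
  exact Real.abs_cos_le_one _

lemma continuous_integral_mul_cos {d : ℕ} {q : Space d → ℝ} (hq : Integrable q) :
    Continuous fun t => ∫ f, q f * Real.cos (inner ℝ f t) := by
  refine continuous_of_dominated (bound := fun f => |q f|)
    (fun t => (integrable_mul_cos hq t).aestronglyMeasurable) (fun t => .of_forall fun f => ?_)
    hq.abs (.of_forall fun f => by fun_prop)
  rw [norm_mul, Real.norm_eq_abs, Real.norm_eq_abs]
  exact mul_le_of_le_one_right (abs_nonneg _) (Real.abs_cos_le_one _)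

/-- Bochner's representation of the quadratic form. -/
lemma sum_sum_integral_cos {d : ℕ} {q : Space d → ℝ} (hq : Integrable q) {ι : Type} [Fintype ι]
    (s : ι → Space d) (b : ι → ℝ) :
    Integrable (fun f => q f * ((∑ i, b i * Real.cos (inner ℝ f (s i))) ^ 2 +
      (∑ i, b i * Real.sin (inner ℝ f (s i))) ^ 2)) ∧
    ∑ i, ∑ j, b i * b j * ∫ f, q f * Real.cos (inner ℝ f (s i - s j)) =
      ∫ f, q f * ((∑ i, b i * Real.cos (inner ℝ f (s i))) ^ 2 +
        (∑ i, b i * Real.sin (inner ℝ f (s i))) ^ 2) := by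
  have key : (fun f => q f * ((∑ i, b i * Real.cos (inner ℝ f (s i))) ^ 2 +
      (∑ i, b i * Real.sin (inner ℝ f (s i))) ^ 2)) =
      fun f => ∑ i, ∑ j, b i * b j * (q f * Real.cos (inner ℝ f (s i - s j))) := by
    ext f
    rw [sq, sq, Finset.sum_mul_sum, Finset.sum_mul_sum, ← Finset.sum_add_distrib, Finset.mul_sum]
    refine Finset.sum_congr rfl fun i _ => ?_
    rw [← Finset.sum_add_distrib, Finset.mul_sum]
    refine Finset.sum_congr rfl fun j _ => ?_
    rw [inner_sub_right, Real.cos_sub]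
    ring
  have hi : ∀ i j, Integrable fun f => b i * b j * (q f * Real.cos (inner ℝ f (s i - s j))) :=
    fun i j => (integrable_mul_cos hq _).const_mul _
  rw [key]
  refine ⟨integrable_finsetSum _ fun i _ => integrable_finsetSum _ fun j _ => hi i j, ?_⟩
  rw [integral_finsetSum _ fun i _ => integrable_finsetSum _ fun j _ => hi i j]
  refine Finset.sum_congr rfl fun i _ => ?_
  rw [integral_finsetSum _ fun j _ => hi i j]
  simp_rw [integral_const_mul]

section Spectral
variable {d p : ℕ} {a b : ℝ} {K : (Fin p → ℝ) → Space d → ℝ} {θ : Fin p → ℝ}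

lemma RegularModel.continuous_fourierTransform (hK : RegularModel a b K)
    (hθ : θ ∈ paramSet p a b) : Continuous (fourierTransform (K θ)) := by
  rw [← continuousOn_univ]
  exact hK.spectral_continuous.comp (f := fun f : Space d => (f, θ)) (by fun_prop)
    fun f _ => ⟨trivial, hθ⟩

lemma RegularModel.integrable_fourierTransform (hK : RegularModel a b K)
    (hθ : θ ∈ paramSet p a b) : Integrable (fourierTransform (K θ)) := by
  have hc := hK.continuous_fourierTransform hθ
  -- If the transform were not integrable, the inversion integral would take its default value 0.
  -- Then `K θ` and its transform would vanish, against positivity.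
  by_contra hni
  have h0 : ∀ t, K θ t = 0 := fun t => by
    have := hK.inversion θ hθ t
    rw [integral_undef] at this
    · exact_mod_cast this
    · intro hint
      refine hni (hint.mono hc.aestronglyMeasurable (.of_forall fun f => ?_))
      rw [norm_mul, mul_comm Complex.I, Complex.norm_exp_ofReal_mul_I, mul_one]
  have := (hK.spectral_pos θ hθ 0).2
  simp [fourierTransform, h0] at this

/-- The real spectral density. -/
def spectralDensity (k : Space d → ℝ) (f : Space d) : ℝ := (fourierTransform k f).re

lemma RegularModel.integrable_spectralDensity (hK : RegularModel a b K)
    (hθ : θ ∈ paramSet p a b) : Integrable (spectralDensity (K θ)) :=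
  (hK.integrable_fourierTransform hθ).re

lemma RegularModel.eq_integral_cos (hK : RegularModel a b K)
    (hθ : θ ∈ paramSet p a b) (t : Space d) :
    K θ t = ∫ f, spectralDensity (K θ) f * Real.cos (inner ℝ f t) := by
  have hi : Integrable fun f : Space d =>
      fourierTransform (K θ) f * Complex.exp (Complex.I * ((inner ℝ f t : ℝ) : ℂ)) := by
    refine (hK.integrable_fourierTransform hθ).mul_bdd (c := 1) (by fun_prop)
      (.of_forall fun f => ?_)
    rw [mul_comm Complex.I, Complex.norm_exp_ofReal_mul_I]
  have h := congrArg Complex.re (hK.inversion θ hθ t)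
  rw [Complex.ofReal_re] at h
  rw [h]
  refine (integral_re hi).symm.trans (integral_congr_ae (.of_forall fun f => ?_))
  simp only [RCLike.re_to_complex, Complex.mul_re, (hK.spectral_pos θ hθ f).1, zero_mul, sub_zero]
  rw [mul_comm Complex.I, Complex.exp_ofReal_mul_I_re, spectralDensity]

lemma RegularModel.continuous (hK : RegularModel a b K) (hθ : θ ∈ paramSet p a b) :
    Continuous (K θ) := by
  have := continuous_integral_mul_cos (hK.integrable_spectralDensity hθ)
  simpa only [← hK.eq_integral_cos hθ] using this

lemma isCompact_paramSet (p : ℕ) (a b : ℝ) : IsCompact (paramSet p a b) := by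
  have : paramSet p a b = Set.univ.pi fun _ => Set.Icc a b := by
    ext; simp only [paramSet, Set.mem_ofPred_eq, Set.mem_univ_pi]
  rw [this]
  exact isCompact_univ_pi fun _ => isCompact_Icc

/-- Compactness of ball times `Θ` turns pointwise positivity into a bound uniform in `θ`; this is
where joint continuity enters. -/
lemma RegularModel.exists_le_spectralDensity (hK : RegularModel a b K) (r : ℝ) (hr : 0 ≤ r) :
    ∃ κ : ℝ, 0 < κ ∧ ∀ θ ∈ paramSet p a b, ∀ f : Space d, ‖f‖ ≤ r →
      κ ≤ spectralDensity (K θ) f := by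
  rcases (paramSet p a b).eq_empty_or_nonempty with he | hne
  · exact ⟨1, one_pos, fun θ hθ => by simp [he] at hθ⟩
  have hcomp : IsCompact (Metric.closedBall (0 : Space d) r ×ˢ paramSet p a b) :=
    (isCompact_closedBall _ _).prod (isCompact_paramSet p a b)
  have hcont : ContinuousOn (fun q : Space d × (Fin p → ℝ) => spectralDensity (K q.2) q.1)
      (Metric.closedBall (0 : Space d) r ×ˢ paramSet p a b) :=
    Complex.continuous_re.comp_continuousOn
      (hK.spectral_continuous.mono (Set.prod_mono (Set.subset_univ _) le_rfl))
  obtain ⟨q, hq, hmin⟩ := hcomp.exists_isMinOn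
    ((Metric.nonempty_closedBall.2 hr).prod hne) hcont
  refine ⟨_, (hK.spectral_pos q.2 hq.2 q.1).2, fun θ hθ f hf => ?_⟩
  exact hmin (a := (f, θ)) ⟨by simpa using hf, hθ⟩

end Spectral

/-! ### Uniform lower bound on the eigenvalues -/

/-- A smooth compactly supported weight, its values and the decay of its cosine transform. -/
lemma exists_weight (d : ℕ) : ∃ ψ : Space d → ℝ, Integrable ψ ∧ (∀ f, 0 ≤ ψ f) ∧ (∀ f, ψ f ≤ 1) ∧
    (∀ f, 2 ≤ ‖f‖ → ψ f = 0) ∧ 0 < (∫ f, ψ f) ∧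
    ∃ C : ℝ, ∀ u, ‖u‖ ^ (d + 1) * |∫ f, ψ f * Real.cos (inner ℝ f u)| ≤ C := by
  let ψ : ContDiffBump (0 : Space d) := ⟨1, 2, one_pos, one_lt_two⟩
  have hcs : HasCompactSupport fun f => (ψ f : ℂ) :=
    ψ.hasCompactSupport.comp_left (g := Complex.ofReal) rfl
  have hcd : ContDiff ℝ (⊤ : ℕ∞) fun f => (ψ f : ℂ) :=
    Complex.ofRealCLM.contDiff.comp ψ.contDiff
  let Ψ := hcs.toSchwartzMap hcd
  obtain ⟨C, -, hC⟩ := (FourierTransform.fourier Ψ).decay (d + 1) 0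
  have hint : Integrable ψ := ψ.continuous.integrable_of_hasCompactSupport ψ.hasCompactSupport
  refine ⟨ψ, hint, fun f => ψ.nonneg, fun f => ψ.le_one, fun f hf => ?_, ?_,
    (2 * Real.pi) ^ (d + 1) * C, fun u => ?_⟩
  · exact ψ.zero_of_le_dist (by simpa using hf)
  · exact ψ.integral_pos
  -- The transform of `Ψ` has phase `-2π⟨v, w⟩`, so the cosine transform at `u` is read off at `w =
  -- u / (2π)`; hence the factor `(2π)^(d+1)`.
  have h1 := hC ((2 * Real.pi)⁻¹ • u)
  rw [norm_iteratedFDeriv_zero, norm_smul, norm_inv, Real.norm_of_nonneg (by positivity),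
    SchwartzMap.fourier_coe, Real.fourier_eq'] at h1
  have h2 : |∫ f, ψ f * Real.cos (inner ℝ f u)| ≤
      ‖∫ v, Complex.exp (↑(-2 * Real.pi * inner ℝ v ((2 * Real.pi)⁻¹ • u)) * Complex.I) • Ψ v‖ := by
    refine le_trans (le_of_eq ?_) (Complex.abs_re_le_norm _)
    have hi : Integrable fun v : Space d =>
        Complex.exp (↑(-2 * Real.pi * inner ℝ v ((2 * Real.pi)⁻¹ • u)) * Complex.I) • Ψ v := by
      refine Ψ.integrable.bdd_mul (c := 1) (by fun_prop) (.of_forall fun f => ?_)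
      rw [Complex.norm_exp_ofReal_mul_I]
    congr 1
    refine Eq.trans (integral_congr_ae (.of_forall fun f => ?_)) (integral_re hi)
    have : -2 * Real.pi * inner ℝ f ((2 * Real.pi)⁻¹ • u) = - inner ℝ f u := by
      rw [inner_smul_right]; field_simp
    have hΨ : Ψ f = (ψ f : ℂ) := rfl
    simp only [this, hΨ, RCLike.re_to_complex, smul_eq_mul, Complex.re_mul_ofReal,
      Complex.exp_ofReal_mul_I_re, Real.cos_neg]
    ring
  calc ‖u‖ ^ (d + 1) * |∫ f, ψ f * Real.cos (inner ℝ f u)|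
      = (2 * Real.pi) ^ (d + 1) * (((2 * Real.pi)⁻¹ * ‖u‖) ^ (d + 1) *
          |∫ f, ψ f * Real.cos (inner ℝ f u)|) := by
        rw [← mul_assoc, ← mul_pow, ← mul_assoc, mul_inv_cancel₀ (by positivity), one_mul]
    _ ≤ _ := by
        refine mul_le_mul_of_nonneg_left (le_trans ?_ h1) (by positivity)
        exact mul_le_mul_of_nonneg_left h2 (by positivity)

lemma norm_pow_inv_le_decay {d : ℕ} {δ : ℝ} (hδ : 0 < δ) {u : Space d} (hu : δ ≤ ‖u‖) :
    (‖u‖ ^ (d + 1))⁻¹ ≤ (1 + δ⁻¹) ^ (d + 1) * decay u := by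
  have hu' : 0 < ‖u‖ := hδ.trans_le hu
  unfold decay
  rw [← div_eq_mul_inv, inv_eq_one_div, div_le_div_iff₀ (by positivity) (by positivity), one_mul,
    ← mul_pow]
  refine pow_le_pow_left₀ (by positivity) ?_ _
  have : 1 ≤ δ⁻¹ * ‖u‖ := by rw [inv_mul_eq_div, one_le_div hδ]; exact hu
  nlinarith

/-- The smallest eigenvalue of the covariance matrices of separated points is bounded away from
zero, uniformly in the points and in the parameter. -/
lemma RegularModel.exists_quadraticForm_ge {d p : ℕ} {a b : ℝ} {K : (Fin p → ℝ) → Space d → ℝ}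
    (hK : RegularModel a b K) {δ : ℝ} (hδ : 0 < δ) :
    ∃ c : ℝ, 0 < c ∧ ∀ θ ∈ paramSet p a b, ∀ (ι : Type) [Fintype ι] (s : ι → Space d),
      Separated δ s → ∀ x : ι → ℝ, c * ∑ i, x i ^ 2 ≤ ∑ i, ∑ j, x i * x j * K θ (s i - s j) := by
  classical
  obtain ⟨S, hS, -, hsum⟩ := exists_sum_decay_le d hδ
  obtain ⟨ψ, hψi, hψ0, hψ1, hψz, hI, C, hC⟩ := exists_weight d
  set I := ∫ f, ψ f
  set h : Space d → ℝ := fun u => ∫ f, ψ f * Real.cos (inner ℝ f u) with hh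
  have hC0 : 0 ≤ C := by
    refine le_trans ?_ (hC 0); positivity
  set C' := C * (1 + δ⁻¹) ^ (d + 1) with hC'
  have hC'0 : 0 ≤ C' := by positivity
  -- The dilation is chosen so that the off-diagonal row sums, at most `C' * S / m`, do not exceed
  -- half of the diagonal entry `I`.
  set m : ℝ := max 1 (2 * C' * S / I) with hm
  have hm1 : 1 ≤ m := le_max_left _ _
  have hm0 : 0 < m := one_pos.trans_le hm1
  have hmI : C' * S / m ≤ I / 2 := by
    have : 2 * C' * S / I ≤ m := le_max_right _ _
    rw [div_le_iff₀ hI] at this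
    rw [div_le_iff₀ hm0]
    linarith
  obtain ⟨κ, hκ, hle⟩ := hK.exists_le_spectralDensity (2 * m) (by positivity)
  have hoff : ∀ u : Space d, δ ≤ ‖u‖ → |h (m • u)| ≤ C' / m * decay u := by
    intro u hu
    have hu' : 0 < ‖u‖ := hδ.trans_le hu
    have h1 := hC (m • u)
    rw [norm_smul, Real.norm_of_nonneg hm0.le, mul_pow] at h1
    have h2 : |h (m • u)| ≤ C * (m ^ (d + 1))⁻¹ * (‖u‖ ^ (d + 1))⁻¹ := by
      rw [mul_assoc, ← mul_inv, ← div_eq_mul_inv, le_div_iff₀ (by positivity), mul_comm]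
      exact h1
    have h3 : (m ^ (d + 1))⁻¹ ≤ m⁻¹ :=
      inv_anti₀ hm0 (le_self_pow₀ hm1 (Nat.succ_ne_zero d))
    calc |h (m • u)| ≤ C * (m ^ (d + 1))⁻¹ * (‖u‖ ^ (d + 1))⁻¹ := h2
      _ ≤ C * m⁻¹ * ((1 + δ⁻¹) ^ (d + 1) * decay u) := by
          gcongr
          exact norm_pow_inv_le_decay hδ hu
      _ = C' / m * decay u := by rw [hC']; ring
  refine ⟨κ * (m ^ d * (I / 2)), by positivity, fun θ hθ ι _ s hs x => ?_⟩
  have hψm : Integrable fun f => ψ (m⁻¹ • f) := hψi.comp_smul (inv_ne_zero hm0.ne')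
  obtain ⟨hi1, he1⟩ := sum_sum_integral_cos (hK.integrable_spectralDensity hθ) s x
  obtain ⟨hi2, he2⟩ := sum_sum_integral_cos hψm s x
  have hscale : ∀ u, ∫ f, ψ (m⁻¹ • f) * Real.cos (inner ℝ f u) = m ^ d * h (m • u) := by
    intro u
    have := Measure.integral_comp_smul (volume : Measure (Space d))
      (fun f => ψ f * Real.cos (inner ℝ f (m • u))) m⁻¹
    simp only [inner_smul_left, inner_smul_right, finrank_euclideanSpace, Fintype.card_fin,
      inv_pow, inv_inv, smul_eq_mul, abs_of_pos (pow_pos hm0 d)] at this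
    rw [hh]
    simp only [inner_smul_right]
    rw [← this]
    refine integral_congr_ae (.of_forall fun f => ?_)
    simp [hm0.ne']
  -- Diagonal dominance: `A` is the off-diagonal part, and its quadratic form costs at most half of
  -- the diagonal one.
  have hdiag : I / 2 * ∑ i, x i ^ 2 ≤ ∑ i, ∑ j, x i * x j * h (m • (s i - s j)) := by
    let A : ι → ι → ℝ := fun i j => if i = j then 0 else h (m • (s i - s j))
    have hA : ∀ i j, |A i j| ≤ C' / m * decay (s i - s j) := by
      intro i j
      by_cases hij : i = j
      · simp only [A, if_pos hij, abs_zero]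
        exact mul_nonneg (by positivity) (decay_pos _).le
      · simp only [A, if_neg hij]
        exact hoff _ (hs i j hij)
    have hcol : ∀ j, ∑ i, |A i j| ≤ I / 2 := fun j => by
      refine (Finset.sum_le_sum fun i _ => hA i j).trans ?_
      rw [← Finset.mul_sum]
      refine le_trans (mul_le_mul_of_nonneg_left (hsum ι s hs (s j)) (by positivity)) ?_
      linarith [hmI, show C' / m * S = C' * S / m by ring]
    have hrow : ∀ i, ∑ j, |A i j| ≤ I / 2 := fun i => by
      refine (Finset.sum_le_sum fun j _ => hA i j).trans ?_
      rw [← Finset.mul_sum]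
      simp_rw [decay_sub_comm (s i)]
      refine le_trans (mul_le_mul_of_nonneg_left (hsum ι s hs (s i)) (by positivity)) ?_
      linarith [hmI, show C' / m * S = C' * S / m by ring]
    have hb := (abs_le.1 (abs_sum_sum_le (b := x) hrow hcol)).1
    have hsplit : ∑ i, ∑ j, x i * x j * h (m • (s i - s j)) =
        I * ∑ i, x i ^ 2 + ∑ i, ∑ j, x i * x j * A i j := by
      rw [Finset.mul_sum, ← Finset.sum_add_distrib]
      refine Finset.sum_congr rfl fun i _ => ?_
      rw [← Finset.add_sum_erase _ _ (Finset.mem_univ i),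
        ← Finset.add_sum_erase _ (fun j => x i * x j * A i j) (Finset.mem_univ i)]
      have h0 : h 0 = I := by simp [hh, I]
      have : A i i = 0 := if_pos rfl
      rw [this, sub_self, smul_zero, h0, mul_zero, zero_add]
      congr 1
      · ring
      · refine Finset.sum_congr rfl fun j hj => ?_
        rw [show A i j = h (m • (s i - s j)) from if_neg (Finset.ne_of_mem_erase hj).symm]
    rw [hsplit]
    linarith
  simp_rw [hK.eq_integral_cos hθ]
  rw [he1]
  calc κ * (m ^ d * (I / 2)) * ∑ i, x i ^ 2
      = κ * (m ^ d * (I / 2 * ∑ i, x i ^ 2)) := by ring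
    _ ≤ κ * (m ^ d * ∑ i, ∑ j, x i * x j * h (m • (s i - s j))) := by gcongr
    _ = κ * ∑ i, ∑ j, x i * x j * ∫ f, ψ (m⁻¹ • f) * Real.cos (inner ℝ f (s i - s j)) := by
        simp_rw [hscale, Finset.mul_sum]
        refine Finset.sum_congr rfl fun i _ => Finset.sum_congr rfl fun j _ => by ring
    _ ≤ _ := by
        rw [he2, ← integral_const_mul]
        refine integral_mono (hi2.const_mul _) hi1 fun f => ?_
        dsimp only
        rw [← mul_assoc]
        -- It remains that `κ ψ(f / m)` lies below the spectral density: on the ball of radius `2 *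
        -- m` by the choice of `κ` and `ψ ≤ 1`, elsewhere because `ψ(f / m) = 0`.
        refine mul_le_mul_of_nonneg_right ?_ (by positivity)
        by_cases hf : ‖f‖ ≤ 2 * m
        · exact (mul_le_of_le_one_right hκ.le (hψ1 _)).trans (hle θ hθ f hf)
        · rw [hψz, mul_zero]
          · exact (hK.spectral_pos θ hθ f).2.le
          · rw [norm_smul, norm_inv, Real.norm_of_nonneg hm0.le, inv_mul_eq_div, le_div_iff₀ hm0]
            linarith

/-! ### Decay and Lipschitz bounds for the kernels -/

section Kernel
variable {d p : ℕ} {a b : ℝ} {K : (Fin p → ℝ) → Space d → ℝ}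

lemma piecewise_mem_paramSet {θ η : Fin p → ℝ} (hθ : θ ∈ paramSet p a b)
    (hη : η ∈ paramSet p a b) (s : Finset (Fin p)) : s.piecewise θ η ∈ paramSet p a b := by
  intro i
  by_cases hi : i ∈ s
  · rw [Finset.piecewise_eq_of_mem _ _ _ hi]; exact hθ i
  · rw [Finset.piecewise_eq_of_notMem _ _ _ hi]; exact hη i

lemma update_mem_paramSet {θ : Fin p → ℝ} (hθ : θ ∈ paramSet p a b) (i : Fin p) {u : ℝ}
    (hu : u ∈ Set.Icc a b) : Function.update θ i u ∈ paramSet p a b := by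
  intro j
  by_cases hj : j = i
  · subst hj; simpa using hu
  · simpa [hj] using hθ j

/-- A bound on a partial derivative gives a Lipschitz bound in the corresponding coordinate. -/
lemma abs_sub_update_le {g : (Fin p → ℝ) → ℝ} {B : ℝ} (i : Fin p)
    (hdiff : ∀ θ ∈ paramSet p a b,
      DifferentiableWithinAt ℝ (fun s => g (Function.update θ i s)) (Set.Icc a b) (θ i))
    (hB : ∀ θ ∈ paramSet p a b, |partialDeriv a b i g θ| ≤ B)
    {θ : Fin p → ℝ} (hθ : θ ∈ paramSet p a b) {u : ℝ} (hu : u ∈ Set.Icc a b) :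
    |g (Function.update θ i u) - g θ| ≤ B * |u - θ i| := by
  have h := Convex.norm_image_sub_le_of_norm_derivWithin_le (𝕜 := ℝ) (C := B)
    (f := fun s => g (Function.update θ i s)) (s := Set.Icc a b) (x := θ i) (y := u)
    (fun s hs => ?_) (fun s hs => ?_) (convex_Icc a b) (hθ i) hu
  · simpa using h
  · simpa using hdiff _ (update_mem_paramSet hθ i hs)
  · simpa [partialDeriv] using hB _ (update_mem_paramSet hθ i hs)

lemma RegularModel.exists_kernel_bounds (hK : RegularModel a b K) :
    ∃ C : ℝ, 0 < C ∧ (∀ θ ∈ paramSet p a b, ∀ t, |K θ t| ≤ C * decay t) ∧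
      ∀ θ ∈ paramSet p a b, ∀ η ∈ paramSet p a b, ∀ t,
        |K θ t - K η t| ≤ C * ‖θ - η‖ * decay t := by
  have hbd : ∀ I : List (Fin p), I.length ≤ 3 → ∃ C : ℝ, 0 ≤ C ∧ ∀ θ ∈ paramSet p a b, ∀ t,
      |iterPartial a b I (fun η => K η t) θ| ≤ C * decay t := by
    intro I hI
    obtain ⟨C, hC⟩ := hK.bound I hI
    refine ⟨|C| * 2 ^ d, by positivity, fun θ hθ t => (hC θ hθ t).trans ?_⟩
    rw [div_eq_mul_one_div, mul_assoc]
    exact (mul_le_mul_of_nonneg_right (le_abs_self C) (by positivity)).trans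
      (mul_le_mul_of_nonneg_left (inv_one_add_norm_pow_le t) (abs_nonneg C))
  obtain ⟨C₀, hC₀, h₀⟩ := hbd [] (by simp)
  choose C hC hder using fun i : Fin p => hbd [i] (by simp)
  have hsum : 0 ≤ ∑ i, C i := Finset.sum_nonneg fun i _ => hC i
  refine ⟨C₀ + ∑ i, C i + 1, by positivity, fun θ hθ t => ?_, fun θ hθ η hη t => ?_⟩
  · refine (h₀ θ hθ t).trans (mul_le_mul_of_nonneg_right ?_ (decay_pos t).le)
    linarith
  -- `η` is changed into `θ` one coordinate at a time; the mixed points stay in the cube, so the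
  -- first-order bounds apply at each change.
  have key : ∀ s : Finset (Fin p),
      |K (s.piecewise θ η) t - K η t| ≤ ∑ i ∈ s, C i * decay t * ‖θ - η‖ := by
    intro s
    induction s using Finset.induction_on with
    | empty => simp
    | insert j s hj ih =>
      rw [Finset.sum_insert hj, Finset.piecewise_insert]
      have h1 := abs_sub_update_le (g := fun η => K η t) (B := C j * decay t) j
        (fun θ hθ => by simpa [iterPartial] using hK.differentiable [] (by simp) j θ hθ t)
        (fun θ hθ => hder j θ hθ t) (piecewise_mem_paramSet hθ hη s) (hθ j)
      rw [Finset.piecewise_eq_of_notMem _ _ _ hj] at h1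
      have h2 : |θ j - η j| ≤ ‖θ - η‖ := norm_le_pi_norm (θ - η) j
      refine (abs_sub_le _ (K (s.piecewise θ η) t) _).trans (add_le_add (h1.trans ?_) ih)
      exact mul_le_mul_of_nonneg_left h2 (mul_nonneg (hC j) (decay_pos t).le)
  have h := key Finset.univ
  rw [Finset.piecewise_univ, ← Finset.sum_mul, ← Finset.sum_mul] at h
  refine h.trans ?_
  rw [mul_right_comm]
  refine mul_le_mul_of_nonneg_right ?_ (decay_pos t).le
  exact mul_le_mul_of_nonneg_right (by linarith) (norm_nonneg _)

end Kernel

/-! ### Bounds on Kriging predictors -/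

/-- Young's inequality for `c * ⟨x, z⟩`. With `z = R x` it turns coercivity of the quadratic form
into `‖R⁻¹‖ ≤ 1 / c`. -/
lemma sum_sq_le_of_mul_sum_sq_le {ι : Type} [Fintype ι] {c : ℝ} (hc : 0 < c) {x z : ι → ℝ}
    (h : c * ∑ i, x i ^ 2 ≤ ∑ i, x i * z i) : c ^ 2 * ∑ i, x i ^ 2 ≤ ∑ i, z i ^ 2 := by
  have h1 : c * ∑ i, x i * z i ≤ c ^ 2 / 2 * ∑ i, x i ^ 2 + (∑ i, z i ^ 2) / 2 := by
    rw [Finset.mul_sum, Finset.mul_sum, Finset.sum_div, ← Finset.sum_add_distrib]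
    refine Finset.sum_le_sum fun i _ => ?_
    nlinarith [sq_nonneg (c * x i - z i)]
  nlinarith [mul_le_mul_of_nonneg_left h hc.le]

lemma sum_sum_eq_sum_mul_mulVec {d n : ℕ} (k : Space d → ℝ) (s : Fin n → Space d)
    (x : Fin n → ℝ) :
    ∑ i, ∑ j, x i * x j * k (s i - s j) = ∑ i, x i * (covMatrix k s *ᵥ x) i := by
  refine Finset.sum_congr rfl fun i _ => ?_
  rw [Matrix.mulVec, dotProduct, Finset.mul_sum]
  refine Finset.sum_congr rfl fun j _ => ?_
  rw [covMatrix, Matrix.of_apply]; ring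

lemma isUnit_det_covMatrix {d n : ℕ} {k : Space d → ℝ} {s : Fin n → Space d} {c : ℝ}
    (hc : 0 < c)
    (hq : ∀ x : Fin n → ℝ, c * ∑ i, x i ^ 2 ≤ ∑ i, ∑ j, x i * x j * k (s i - s j)) :
    IsUnit (covMatrix k s).det := by
  rw [isUnit_iff_ne_zero]
  intro h0
  obtain ⟨x, hx, hx0⟩ := Matrix.exists_mulVec_eq_zero_iff.2 h0
  have h := hq x
  rw [sum_sum_eq_sum_mul_mulVec, hx0] at h
  simp only [Pi.zero_apply, mul_zero, Finset.sum_const_zero] at h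
  refine hx (funext fun i => ?_)
  have h1 : x i ^ 2 ≤ ∑ i, x i ^ 2 :=
    Finset.single_le_sum (f := fun i => x i ^ 2) (fun i _ => sq_nonneg _) (Finset.mem_univ i)
  have h2 : x i ^ 2 ≤ 0 := h1.trans (by nlinarith)
  simpa using le_antisymm h2 (sq_nonneg _)

lemma sum_sq_le_sum_sq_mulVec {d n : ℕ} {k : Space d → ℝ} {s : Fin n → Space d} {c : ℝ}
    (hc : 0 < c)
    (hq : ∀ x : Fin n → ℝ, c * ∑ i, x i ^ 2 ≤ ∑ i, ∑ j, x i * x j * k (s i - s j))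
    (x : Fin n → ℝ) :
    c ^ 2 * ∑ i, x i ^ 2 ≤ ∑ i, (covMatrix k s *ᵥ x) i ^ 2 :=
  sum_sq_le_of_mul_sum_sq_le hc ((hq x).trans (sum_sum_eq_sum_mul_mulVec k s x).le)

lemma predictor_eq_sum {d n : ℕ} (k : Space d → ℝ) (s : Fin n → Space d) (y : Fin n → ℝ)
    (t : Space d) :
    predictor k s y t = ∑ j, ((covMatrix k s)⁻¹ *ᵥ y) j * k (s j - t) := by
  rw [predictor, dotProduct]
  exact Finset.sum_congr rfl fun j _ => mul_comm _ _

lemma continuous_predictor {d n : ℕ} {k : Space d → ℝ} (hk : Continuous k)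
    (s : Fin n → Space d) (y : Fin n → ℝ) : Continuous (predictor k s y) := by
  simp only [funext (predictor_eq_sum k s y)]
  fun_prop

lemma isCompact_cube (d N : ℕ) : IsCompact (cube d N) := by
  have h : cube d N = WithLp.ofLp (p := 2) ⁻¹' (Set.univ.pi fun _ : Fin d => Set.Icc 0 (N : ℝ)) := by
    ext; simp only [cube, Set.mem_ofPred_eq, Set.mem_preimage, Set.mem_univ_pi]
  rw [h]
  exact (EuclideanSpace.equiv (Fin d) ℝ).toHomeomorph.isCompact_preimage.2
    (isCompact_univ_pi fun _ => isCompact_Icc)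

lemma integrableOn_cube {d N : ℕ} {f : Space d → ℝ} (hf : Continuous f) :
    IntegrableOn f (cube d N) :=
  hf.continuousOn.integrableOn_compact (isCompact_cube d N)

section Predictor
variable {d p : ℕ} {a b : ℝ} {K : (Fin p → ℝ) → Space d → ℝ}

/-- `L²` bounds on predictors and on their dependence on the covariance parameter. -/
lemma RegularModel.exists_predictor_bounds (hK : RegularModel a b K) {δ : ℝ} (hδ : 0 < δ) :
    ∃ A : ℝ, 0 < A ∧ ∀ (n N : ℕ) (s : Fin n → Space d), Separated δ s → ∀ y : Fin n → ℝ,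
      (∀ θ ∈ paramSet p a b,
        ∫ t in cube d N, predictor (K θ) s y t ^ 2 ≤ A * ∑ i, y i ^ 2) ∧
      ∀ θ ∈ paramSet p a b, ∀ η ∈ paramSet p a b,
        ∫ t in cube d N, (predictor (K θ) s y t - predictor (K η) s y t) ^ 2 ≤
          A * ‖θ - η‖ ^ 2 * ∑ i, y i ^ 2 := by
  obtain ⟨S, hS, hJ, hsum⟩ := exists_sum_decay_le d hδ
  obtain ⟨c, hc, hq⟩ := hK.exists_quadraticForm_ge hδ
  obtain ⟨C, hC, hb, hlip⟩ := hK.exists_kernel_bounds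
  set M := C * S
  have hM : 0 < M := by positivity
  -- The first term serves the bound on the predictor; the other two are the costs of changing the
  -- coefficients and the kernel.
  refine ⟨M ^ 2 / c ^ 2 + 2 * (M ^ 2 / c ^ 2) ^ 2 + 2 * (M ^ 2 / c ^ 2), by positivity,
    fun n N s hs y => ?_⟩
  have hsum' : ∀ i, ∑ j, decay (s i - s j) ≤ S := fun i => by
    simp_rw [decay_sub_comm (s i)]
    exact hsum _ s hs (s i)
  have hy : 0 ≤ ∑ i, y i ^ 2 := Finset.sum_nonneg fun i _ => sq_nonneg _
  have hinv : ∀ θ ∈ paramSet p a b,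
      c ^ 2 * ∑ i, ((covMatrix (K θ) s)⁻¹ *ᵥ y) i ^ 2 ≤ ∑ i, y i ^ 2 := fun θ hθ => by
    have h := sum_sq_le_sum_sq_mulVec hc (hq θ hθ _ s hs) ((covMatrix (K θ) s)⁻¹ *ᵥ y)
    rwa [Matrix.mulVec_mulVec, Matrix.mul_nonsing_inv _
      (isUnit_det_covMatrix hc (hq θ hθ _ s hs)), Matrix.one_mulVec] at h
  have hinv' : ∀ θ ∈ paramSet p a b,
      ∑ i, ((covMatrix (K θ) s)⁻¹ *ᵥ y) i ^ 2 ≤ (∑ i, y i ^ 2) / c ^ 2 := fun θ hθ => by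
    rw [le_div_iff₀ (by positivity), mul_comm]
    exact hinv θ hθ
  have hsynth : ∀ (g : Space d → ℝ) (B : ℝ), 0 ≤ B → Continuous g → (∀ t, |g t| ≤ B * decay t) →
      ∀ x : Fin n → ℝ, ∫ t in cube d N, (∑ j, x j * g (s j - t)) ^ 2 ≤
        (B * S) ^ 2 * ∑ j, x j ^ 2 := by
    intro g B hB hg hgB x
    have hgi : Integrable g := ((integrable_decay d).const_mul B).mono hg.aestronglyMeasurable
      (.of_forall fun t => by
        rw [Real.norm_eq_abs, Real.norm_of_nonneg (mul_nonneg hB (decay_pos t).le)]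
        exact hgB t)
    refine setIntegral_sq_sum_le (fun j => hgi.comp_sub_left (s j)) (by positivity)
      (fun t => ?_) fun j => ?_
    · refine (Finset.sum_le_sum fun j _ => hgB (s j - t)).trans ?_
      rw [← Finset.mul_sum]
      exact mul_le_mul_of_nonneg_left (hsum _ s hs t) hB
    · rw [integral_sub_left_eq_self (fun t => |g t|) volume (s j)]
      refine (integral_mono hgi.abs ((integrable_decay d).const_mul B) hgB).trans ?_
      rw [integral_const_mul]
      exact mul_le_mul_of_nonneg_left hJ hB
  refine ⟨fun θ hθ => ?_, fun θ hθ η hη => ?_⟩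
  · simp_rw [predictor_eq_sum]
    refine (hsynth (K θ) C hC.le (hK.continuous hθ) (hb θ hθ) _).trans ?_
    calc M ^ 2 * ∑ j, ((covMatrix (K θ) s)⁻¹ *ᵥ y) j ^ 2 ≤ M ^ 2 * ((∑ i, y i ^ 2) / c ^ 2) :=
          mul_le_mul_of_nonneg_left (hinv' θ hθ) (by positivity)
      _ = M ^ 2 / c ^ 2 * ∑ i, y i ^ 2 := by ring
      _ ≤ _ := by
          refine mul_le_mul_of_nonneg_right ?_ hy
          have : 0 ≤ 2 * (M ^ 2 / c ^ 2) ^ 2 + 2 * (M ^ 2 / c ^ 2) := by positivity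
          linarith
  set τ := ‖θ - η‖
  set α := (covMatrix (K η) s)⁻¹ *ᵥ y with hα
  set β := (covMatrix (K θ) s)⁻¹ *ᵥ y with hβ
  have hαβ : ∑ i, (β i - α i) ^ 2 ≤ (M * τ) ^ 2 / c ^ 4 * ∑ i, y i ^ 2 := by
    have h1 := sum_sq_le_sum_sq_mulVec hc (hq θ hθ _ s hs) (β - α)
    -- Resolvent identity: `R_θ β = y = R_η α` gives `R_θ (β - α) = (R_η - R_θ) α`.
    have h2 : ∀ i, (covMatrix (K θ) s *ᵥ (β - α)) i =
        ∑ j, α j * (K η (s i - s j) - K θ (s i - s j)) := by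
      intro i
      have e1 : covMatrix (K θ) s *ᵥ β = y := by
        rw [hβ, Matrix.mulVec_mulVec, Matrix.mul_nonsing_inv _
          (isUnit_det_covMatrix hc (hq θ hθ _ s hs)), Matrix.one_mulVec]
      have e2 : covMatrix (K η) s *ᵥ α = y := by
        rw [hα, Matrix.mulVec_mulVec, Matrix.mul_nonsing_inv _
          (isUnit_det_covMatrix hc (hq η hη _ s hs)), Matrix.one_mulVec]
      rw [Matrix.mulVec_sub, e1, ← e2, ← Matrix.sub_mulVec]
      simp only [Matrix.mulVec, dotProduct, covMatrix, Matrix.sub_apply, Matrix.of_apply]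
      exact Finset.sum_congr rfl fun j _ => mul_comm _ _
    simp_rw [h2, Pi.sub_apply] at h1
    have hent : ∀ i j, |K η (s i - s j) - K θ (s i - s j)| ≤ C * τ * decay (s i - s j) :=
      fun i j => by rw [abs_sub_comm]; exact hlip θ hθ η hη _
    have hMτ : C * τ * S = M * τ := by simp only [M]; ring
    have h3 := sum_sq_mulVec_le (A := fun i j => K η (s i - s j) - K θ (s i - s j)) (b := α)
      (M := M * τ) (fun i => by
        refine (Finset.sum_le_sum fun j _ => hent i j).trans ?_
        rw [← Finset.mul_sum, ← hMτ]
        exact mul_le_mul_of_nonneg_left (hsum' i) (by positivity)) (fun j => by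
        refine (Finset.sum_le_sum fun i _ => hent i j).trans ?_
        rw [← Finset.mul_sum, ← hMτ]
        exact mul_le_mul_of_nonneg_left (hsum _ s hs (s j)) (by positivity))
    have h4 : (M * τ) ^ 2 * ∑ j, α j ^ 2 ≤ (M * τ) ^ 2 * ((∑ i, y i ^ 2) / c ^ 2) :=
      mul_le_mul_of_nonneg_left (hinv' η hη) (by positivity)
    have h5 := h1.trans (h3.trans h4)
    rw [← mul_div_assoc, le_div_iff₀ (by positivity)] at h5
    rw [div_mul_eq_mul_div, le_div_iff₀ (by positivity)]
    calc (∑ i, (β i - α i) ^ 2) * c ^ 4 = c ^ 2 * (∑ i, (β i - α i) ^ 2) * c ^ 2 := by ring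
      _ ≤ _ := h5
  have hcont := hK.continuous hθ
  have hcont' := hK.continuous hη
  have hpt : ∀ t, (predictor (K θ) s y t - predictor (K η) s y t) ^ 2 ≤
      2 * (∑ j, (β j - α j) * K θ (s j - t)) ^ 2 +
        2 * (∑ j, α j * (K θ (s j - t) - K η (s j - t))) ^ 2 := by
    intro t
    have : predictor (K θ) s y t - predictor (K η) s y t =
        ∑ j, (β j - α j) * K θ (s j - t) + ∑ j, α j * (K θ (s j - t) - K η (s j - t)) := by
      rw [predictor_eq_sum, predictor_eq_sum, ← Finset.sum_add_distrib, ← Finset.sum_sub_distrib]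
      exact Finset.sum_congr rfl fun j _ => by ring
    rw [this]
    nlinarith [sq_nonneg (∑ j, (β j - α j) * K θ (s j - t) -
      ∑ j, α j * (K θ (s j - t) - K η (s j - t)))]
  have hi1 : IntegrableOn (fun t => 2 * (∑ j, (β j - α j) * K θ (s j - t)) ^ 2) (cube d N) :=
    integrableOn_cube (by fun_prop)
  have hi2 : IntegrableOn (fun t => 2 * (∑ j, α j * (K θ (s j - t) - K η (s j - t))) ^ 2)
    (cube d N) := integrableOn_cube (by fun_prop)
  have hp1 := continuous_predictor hcont s y
  have hp2 := continuous_predictor hcont' s y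
  calc ∫ t in cube d N, (predictor (K θ) s y t - predictor (K η) s y t) ^ 2
      ≤ ∫ t in cube d N, (2 * (∑ j, (β j - α j) * K θ (s j - t)) ^ 2 +
        2 * (∑ j, α j * (K θ (s j - t) - K η (s j - t))) ^ 2) :=
        integral_mono (integrableOn_cube (by fun_prop)) (integrableOn_cube (by fun_prop)) hpt
    _ = 2 * (∫ t in cube d N, (∑ j, (β j - α j) * K θ (s j - t)) ^ 2) +
        2 * ∫ t in cube d N, (∑ j, α j * (K θ (s j - t) - K η (s j - t))) ^ 2 := by
        rw [integral_add hi1 hi2, integral_const_mul, integral_const_mul]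
    _ ≤ 2 * (M ^ 2 * ((M * τ) ^ 2 / c ^ 4 * ∑ i, y i ^ 2)) +
        2 * ((M * τ) ^ 2 * ((∑ i, y i ^ 2) / c ^ 2)) := by
        gcongr
        · exact (hsynth (K θ) C hC.le hcont (hb θ hθ) _).trans
            (mul_le_mul_of_nonneg_left hαβ (by positivity))
        · refine (hsynth (fun t => K θ t - K η t) (C * τ) (by positivity) (by fun_prop)
            (hlip θ hθ η hη) α).trans ?_
          rw [show C * τ * S = M * τ by simp only [M]; ring]
          exact mul_le_mul_of_nonneg_left (hinv' η hη) (by positivity)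
    _ = (2 * (M ^ 2 / c ^ 2) ^ 2 + 2 * (M ^ 2 / c ^ 2)) * τ ^ 2 * ∑ i, y i ^ 2 := by
        field_simp
    _ ≤ _ := by
        have : 0 ≤ M ^ 2 / c ^ 2 := by positivity
        gcongr
        linarith

/-- The energy of a trajectory on the observation points and on the prediction domain. -/
def energy {d : ℕ} (v : ℕ → Fin d → ℕ) (ε : ℝ) (n N : ℕ) (x : ℕ → Space d)
    (path : Space d → ℝ) : ℝ :=
  (1 / (N : ℝ) ^ d) * (∑ i, path (obsPoints v ε x n i) ^ 2 + ∫ t in cube d N, path t ^ 2)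

lemma energy_nonneg (v : ℕ → Fin d → ℕ) (ε : ℝ) (n N : ℕ) (x : ℕ → Space d)
    (path : Space d → ℝ) : 0 ≤ energy v ε n N x path := by
  have : 0 ≤ ∫ t in cube d N, path t ^ 2 := integral_nonneg fun t => sq_nonneg _
  unfold energy
  positivity

lemma predError_nonneg (v : ℕ → Fin d → ℕ) (ε : ℝ) (n N : ℕ) (k : Space d → ℝ)
    (x : ℕ → Space d) (path : Space d → ℝ) : 0 ≤ predError v ε n N k x path :=
  mul_nonneg (by positivity) (integral_nonneg fun t => sq_nonneg _)

/-- With `f`, `g` the two predictors, the squared errors differ by `(f - g) (f + g - 2 path)`.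
Young's inequality with weight `τ = ‖θ - η‖` balances the first factor, of `L²` size `O(τ)`, against
the second, of size `O(1)`, leaving one power of `τ`. -/
lemma RegularModel.exists_predError_bounds (hK : RegularModel a b K) {δ : ℝ} (hδ : 0 < δ) :
    ∃ A : ℝ, 0 < A ∧ ∀ (v : ℕ → Fin d → ℕ) (ε : ℝ) (n N : ℕ) (x : ℕ → Space d)
      (path : Space d → ℝ), Separated δ (obsPoints v ε x n) → Continuous path →
      (∀ θ ∈ paramSet p a b, predError v ε n N (K θ) x path ≤ A * energy v ε n N x path) ∧
      ∀ θ ∈ paramSet p a b, ∀ η ∈ paramSet p a b,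
        |predError v ε n N (K θ) x path - predError v ε n N (K η) x path| ≤
          A * ‖θ - η‖ * energy v ε n N x path := by
  obtain ⟨A, hA, hbd⟩ := hK.exists_predictor_bounds hδ
  refine ⟨4 * A + 6, by positivity, fun v ε n N x path hs hpath => ?_⟩
  set s := obsPoints v ε x n with hsdef
  set y : Fin n → ℝ := fun i => path (s i) with hy
  obtain ⟨h1, h2⟩ := hbd n N s hs y
  have hy0 : 0 ≤ ∑ i, y i ^ 2 := Finset.sum_nonneg fun i _ => sq_nonneg _
  have hp0 : 0 ≤ ∫ t in cube d N, path t ^ 2 := integral_nonneg fun t => sq_nonneg _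
  have hN : 0 ≤ 1 / (N : ℝ) ^ d := by positivity
  have hip : IntegrableOn (fun t => path t ^ 2) (cube d N) := integrableOn_cube (by fun_prop)
  refine ⟨fun θ hθ => ?_, fun θ hθ η hη => ?_⟩
  · have hc := continuous_predictor (hK.continuous hθ) s y
    have hi : IntegrableOn (fun t => predictor (K θ) s y t ^ 2) (cube d N) :=
      integrableOn_cube (by fun_prop)
    have h3 : ∫ t in cube d N, (predictor (K θ) s y t - path t) ^ 2 ≤
        2 * (∫ t in cube d N, predictor (K θ) s y t ^ 2) + 2 * ∫ t in cube d N, path t ^ 2 := by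
      rw [← integral_const_mul, ← integral_const_mul,
        ← integral_add (hi.const_mul 2) (hip.const_mul 2)]
      refine integral_mono (integrableOn_cube (by fun_prop))
        ((hi.const_mul 2).add (hip.const_mul 2)) fun t => ?_
      dsimp only
      nlinarith [sq_nonneg (predictor (K θ) s y t + path t)]
    unfold predError energy
    rw [mul_left_comm (4 * A + 6)]
    refine mul_le_mul_of_nonneg_left ?_ hN
    have := h1 θ hθ
    nlinarith [mul_nonneg hA.le hy0, mul_nonneg hA.le hp0]
  -- The weight `τ⁻¹` below requires `τ ≠ 0`.
  rcases eq_or_ne θ η with rfl | hne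
  · simp
  set τ := ‖θ - η‖
  have hτ : 0 < τ := norm_pos_iff.2 (sub_ne_zero.2 hne)
  have hc := continuous_predictor (hK.continuous hθ) s y
  have hc' := continuous_predictor (hK.continuous hη) s y
  set f := predictor (K θ) s y
  set g := predictor (K η) s y
  have hif : IntegrableOn (fun t => f t ^ 2) (cube d N) := integrableOn_cube (by fun_prop)
  have hig : IntegrableOn (fun t => g t ^ 2) (cube d N) := integrableOn_cube (by fun_prop)
  have hifg : IntegrableOn (fun t => (f t - g t) ^ 2) (cube d N) :=
    integrableOn_cube (by fun_prop)
  have h3 : |(∫ t in cube d N, (f t - path t) ^ 2) - ∫ t in cube d N, (g t - path t) ^ 2| ≤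
      (τ⁻¹ / 2 * ∫ t in cube d N, (f t - g t) ^ 2) + τ / 2 * (3 * (∫ t in cube d N, f t ^ 2) +
        3 * (∫ t in cube d N, g t ^ 2) + 12 * ∫ t in cube d N, path t ^ 2) := by
    have j1 : IntegrableOn (fun t => 3 * f t ^ 2 + 3 * g t ^ 2) (cube d N) :=
      integrableOn_cube (by fun_prop)
    have j2 : IntegrableOn (fun t => τ / 2 * (3 * f t ^ 2 + 3 * g t ^ 2 + 12 * path t ^ 2))
      (cube d N) := integrableOn_cube (by fun_prop)
    have j3 : ∫ t in cube d N, (τ⁻¹ / 2 * (f t - g t) ^ 2 +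
        τ / 2 * (3 * f t ^ 2 + 3 * g t ^ 2 + 12 * path t ^ 2)) =
        (τ⁻¹ / 2 * ∫ t in cube d N, (f t - g t) ^ 2) + τ / 2 * (3 * (∫ t in cube d N, f t ^ 2) +
          3 * (∫ t in cube d N, g t ^ 2) + 12 * ∫ t in cube d N, path t ^ 2) := by
      rw [integral_add (hifg.const_mul _) j2, integral_const_mul, integral_const_mul,
        integral_add j1 (hip.const_mul 12), integral_add (hif.const_mul 3) (hig.const_mul 3),
        integral_const_mul, integral_const_mul, integral_const_mul]
    rw [← integral_sub (integrableOn_cube (by fun_prop)) (integrableOn_cube (by fun_prop)), ← j3]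
    refine abs_integral_le_integral_abs.trans (integral_mono (integrableOn_cube (by fun_prop))
      (integrableOn_cube (by fun_prop)) fun t => ?_)
    dsimp only
    set u := f t - g t
    set w := f t + g t - 2 * path t
    have e1 : (f t - path t) ^ 2 - (g t - path t) ^ 2 = u * w := by simp only [u, w]; ring
    have e2 : w ^ 2 ≤ 3 * f t ^ 2 + 3 * g t ^ 2 + 12 * path t ^ 2 := by
      nlinarith [sq_nonneg (f t - g t), sq_nonneg (f t + 2 * path t), sq_nonneg (g t + 2 * path t)]
    have e3 : |u * w| ≤ τ⁻¹ / 2 * u ^ 2 + τ / 2 * w ^ 2 := by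
      have e4 : τ⁻¹ / 2 * u ^ 2 + τ / 2 * w ^ 2 - |u * w| = τ⁻¹ / 2 * (|u| - τ * |w|) ^ 2 := by
        rw [abs_mul, ← sq_abs u, ← sq_abs w]; field_simp; ring
      have : 0 ≤ τ⁻¹ / 2 * (|u| - τ * |w|) ^ 2 := by positivity
      linarith
    rw [e1]
    exact e3.trans (by gcongr)
  unfold predError energy
  rw [← mul_sub, abs_mul, abs_of_nonneg hN, mul_left_comm ((4 * A + 6) * τ)]
  refine mul_le_mul_of_nonneg_left (h3.trans ?_) hN
  have i1 : τ⁻¹ / 2 * ∫ t in cube d N, (f t - g t) ^ 2 ≤ τ⁻¹ / 2 * (A * τ ^ 2 * ∑ i, y i ^ 2) :=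
    mul_le_mul_of_nonneg_left (h2 θ hθ η hη) (by positivity)
  have i2 : τ⁻¹ / 2 * (A * τ ^ 2 * ∑ i, y i ^ 2) = τ * (A / 2 * ∑ i, y i ^ 2) := by field_simp
  have i3 := h1 θ hθ
  have i4 := h1 η hη
  have i5 : A / 2 * ∑ i, y i ^ 2 + (3 * (∫ t in cube d N, f t ^ 2) +
        3 * (∫ t in cube d N, g t ^ 2) + 12 * ∫ t in cube d N, path t ^ 2) / 2 ≤
      (4 * A + 6) * (∑ i, y i ^ 2 + ∫ t in cube d N, path t ^ 2) := by
    nlinarith [mul_nonneg hA.le hy0, mul_nonneg hA.le hp0]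
  have i6 := mul_le_mul_of_nonneg_left i5 hτ.le
  linarith

end Predictor

/-! ### Geometry of the perturbed grid -/

/-- Counting: `N ^ d` indices are mapped onto `N ^ d` points. As `d ≥ 1`, `N ≤ N ^ d`, so a large
`N` captures any two indices. -/
lemma IsGridEnumeration.injective {d : ℕ} (hd : 1 ≤ d) {v : ℕ → Fin d → ℕ}
    (hv : IsGridEnumeration v) : Function.Injective v := by
  intro i j hij
  set N := max i j + 1 with hN
  have himage : (Finset.range (N ^ d)).image v = Fintype.piFinset fun _ => Finset.Icc 1 N := by
    have h := hv N (by omega)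
    ext u
    have hu := Set.ext_iff.1 h u
    simp only [Set.mem_image, Set.mem_ofPred_eq] at hu
    simpa [Finset.mem_image, Fintype.mem_piFinset] using hu
  have hinj : Set.InjOn v (Finset.range (N ^ d)) := by
    refine Finset.injOn_of_card_image_eq ?_
    rw [himage]
    simp
  have hle : N ≤ N ^ d := Nat.le_self_pow (by omega) N
  refine hinj ?_ ?_ hij <;> simp only [Finset.coe_range, Set.mem_Iio] <;> omega

/-- The common separation constant of observation points and test points. -/
def gap (ε : ℝ) : ℝ := 1 / 4 - ε / 2

lemma gap_pos {ε : ℝ} (hε : ε < 1 / 2) : 0 < gap ε := by unfold gap; linarith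

lemma abs_mul_le_of_mem_Icc {ε u : ℝ} (hε₀ : 0 ≤ ε) (hu : u ∈ Set.Icc (-1 : ℝ) 1) :
    |ε * u| ≤ ε := by
  rw [abs_mul, abs_of_nonneg hε₀]
  exact mul_le_of_le_one_right hε₀ (abs_le.2 hu)

lemma separated_obsPoints {d : ℕ} {v : ℕ → Fin d → ℕ} (hv : Function.Injective v)
    {ε : ℝ} (hε₀ : 0 ≤ ε) (hε : ε < 1 / 2) {x : ℕ → Space d}
    (hx : ∀ i k, x i k ∈ Set.Icc (-1 : ℝ) 1) (n : ℕ) :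
    Separated (gap ε) (obsPoints v ε x n) := by
  intro i j hij
  have hne : v i ≠ v j := fun h => hij (Fin.ext (hv h))
  obtain ⟨k, hk⟩ := Function.ne_iff.1 hne
  refine le_trans ?_ (PiLp.norm_apply_le (obsPoints v ε x n i - obsPoints v ε x n j) k)
  have h1 := abs_le.1 (abs_mul_le_of_mem_Icc hε₀ (hx i k))
  have h2 := abs_le.1 (abs_mul_le_of_mem_Icc hε₀ (hx j k))
  simp only [obsPoints, PiLp.sub_apply, PiLp.add_apply, PiLp.smul_apply, smul_eq_mul,
    Real.norm_eq_abs, gap]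
  rcases lt_or_gt_of_ne hk with h | h
  · have : (v i k : ℝ) + 1 ≤ v j k := by exact_mod_cast h
    rw [le_abs]; right; linarith
  · have : (v j k : ℝ) + 1 ≤ v i k := by exact_mod_cast h
    rw [le_abs]; left; linarith

/-- An axis-parallel box. -/
def box {d : ℕ} (l u : Fin d → ℝ) : Set (Space d) := {t | ∀ k, t k ∈ Set.Icc (l k) (u k)}

lemma box_eq_preimage {d : ℕ} (l u : Fin d → ℝ) :
    box l u = WithLp.ofLp (p := 2) ⁻¹' Set.Icc l u := by
  ext t
  simp only [box, Set.mem_ofPred_eq, Set.mem_preimage, Set.mem_Icc, Pi.le_def, forall_and]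

lemma measurableSet_box {d : ℕ} (l u : Fin d → ℝ) : MeasurableSet (box l u) := by
  rw [box_eq_preimage]
  exact (PiLp.volume_preserving_ofLp (Fin d)).measurable measurableSet_Icc

lemma volume_box {d : ℕ} (l u : Fin d → ℝ) :
    volume (box l u) = ∏ k, ENNReal.ofReal (u k - l k) := by
  rw [box_eq_preimage, (PiLp.volume_preserving_ofLp (Fin d)).measure_preimage
    measurableSet_Icc.nullMeasurableSet, Real.volume_Icc_pi]

lemma cube_eq_box (d N : ℕ) : cube d N = box (fun _ => 0) fun _ => (N : ℝ) := rfl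

lemma volume_cube (d N : ℕ) : volume (cube d N) = (N : ENNReal) ^ d := by
  rw [cube_eq_box, volume_box]
  simp

/-- The points of the cube whose coordinates are close to half-integers. -/
def testSet (d N : ℕ) (ρ : ℝ) : Set (Space d) :=
  ⋃ u : Fin d → Fin N, box (fun k => (u k : ℝ) + 1 / 2 - ρ) fun k => (u k : ℝ) + 1 / 2 + ρ

lemma measurableSet_testSet (d N : ℕ) (ρ : ℝ) : MeasurableSet (testSet d N ρ) :=
  .iUnion fun _ => measurableSet_box _ _

lemma testSet_subset_cube (d N : ℕ) {ρ : ℝ} (hρ : ρ ≤ 1 / 4) : testSet d N ρ ⊆ cube d N := by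
  intro t ht k
  obtain ⟨u, hu⟩ := Set.mem_iUnion.1 ht
  obtain ⟨h1, h2⟩ := hu k
  have h3 : ((u k : ℕ) : ℝ) + 1 ≤ N := by exact_mod_cast (u k).2
  have h4 : (0 : ℝ) ≤ (u k : ℕ) := Nat.cast_nonneg _
  exact ⟨by linarith, by linarith⟩

lemma volume_testSet (d N : ℕ) {ρ : ℝ} (hρ : ρ ≤ 1 / 4) :
    volume (testSet d N ρ) = (N : ENNReal) ^ d * ENNReal.ofReal (2 * ρ) ^ d := by
  have hdisj : Pairwise (Function.onFun Disjoint fun u : Fin d → Fin N =>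
      box (fun k => (u k : ℝ) + 1 / 2 - ρ) fun k => (u k : ℝ) + 1 / 2 + ρ) := by
    intro u w huw
    refine Set.disjoint_left.2 fun t hu hw => huw (funext fun k => Fin.ext ?_)
    obtain ⟨h1, h2⟩ := hu k
    obtain ⟨h3, h4⟩ := hw k
    by_contra hne
    rcases lt_or_gt_of_ne hne with h | h
    · have : ((u k : ℕ) : ℝ) + 1 ≤ (w k : ℕ) := by exact_mod_cast h
      linarith
    · have : ((w k : ℕ) : ℝ) + 1 ≤ (u k : ℕ) := by exact_mod_cast h
      linarith
  rw [testSet, measure_iUnion hdisj fun _ => measurableSet_box _ _, tsum_fintype]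
  have : ∀ u : Fin d → Fin N, volume (box (fun k => (u k : ℝ) + 1 / 2 - ρ)
      fun k => (u k : ℝ) + 1 / 2 + ρ) = ENNReal.ofReal (2 * ρ) ^ d := by
    intro u
    rw [volume_box, Finset.prod_congr rfl fun k _ => by
      rw [show (u k : ℝ) + 1 / 2 + ρ - ((u k : ℝ) + 1 / 2 - ρ) = 2 * ρ by ring]]
    simp
  rw [Finset.sum_congr rfl fun u _ => this u]
  simp

/-- One coordinate suffices. An integer is at least `1/2` away from a half-integer; the perturbation
takes off `ε` and the box `gap ε`, and `1/2 - ε - gap ε = gap ε`, which explains the value of `gap`.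
-/
lemma separated_option_obsPoints {d : ℕ} (hd : 1 ≤ d) {v : ℕ → Fin d → ℕ}
    (hv : Function.Injective v) {ε : ℝ} (hε₀ : 0 ≤ ε) (hε : ε < 1 / 2) {x : ℕ → Space d}
    (hx : ∀ i k, x i k ∈ Set.Icc (-1 : ℝ) 1) (n : ℕ) {N : ℕ} {t : Space d}
    (ht : t ∈ testSet d N (gap ε)) :
    Separated (gap ε) (fun i : Option (Fin n) => i.elim t (obsPoints v ε x n)) := by
  have key : ∀ i, gap ε ≤ ‖obsPoints v ε x n i - t‖ := by
    intro i
    obtain ⟨u, hu⟩ := Set.mem_iUnion.1 ht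
    let k : Fin d := ⟨0, hd⟩
    obtain ⟨h1, h2⟩ := hu k
    refine le_trans ?_ (PiLp.norm_apply_le (obsPoints v ε x n i - t) k)
    have h3 := abs_le.1 (abs_mul_le_of_mem_Icc hε₀ (hx i k))
    simp only [gap] at h1 h2
    simp only [obsPoints, PiLp.sub_apply, PiLp.add_apply, PiLp.smul_apply, smul_eq_mul,
      Real.norm_eq_abs, gap]
    rcases le_or_gt (v i k) (u k) with h | h
    · have : (v i k : ℝ) ≤ (u k : ℕ) := by exact_mod_cast h
      rw [le_abs]; right; linarith
    · have : ((u k : ℕ) : ℝ) + 1 ≤ v i k := by exact_mod_cast h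
      rw [le_abs]; left; linarith
  rintro (_ | i) (_ | j) hij
  · exact absurd rfl hij
  · simpa [norm_sub_rev] using key j
  · exact key i
  · exact separated_obsPoints hv hε₀ hε hx n i j fun h => hij (congrArg some h)

/-! ### Second moments of the process -/

section Trajectory
variable {d : ℕ} {Ω : Type*} [MeasurableSpace Ω] {P : Measure Ω}

/-- The second-order structure of a process with continuous trajectories. -/
structure IsContinuousProcess (Y : Space d → Ω → ℝ) (k : Space d → ℝ) (P : Measure Ω) :
    Prop where
  measurable : ∀ t, Measurable (Y t)
  continuous : ∀ ω, Continuous fun t => Y t ω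
  integrable_mul : ∀ s t, Integrable (fun ω => Y s ω * Y t ω) P
  integral_mul : ∀ s t, ∫ ω, Y s ω * Y t ω ∂P = k (s - t)

/-- Setting `Y` to zero on a measurable null set that contains all discontinuous trajectories makes
every trajectory continuous, which gives joint measurability in `(t, ω)`. -/
lemma IsCenteredGaussianProcess.exists_isContinuousProcess [IsProbabilityMeasure P]
    {Y : Space d → Ω → ℝ} {k : Space d → ℝ} (hY : IsCenteredGaussianProcess Y k P)
    (hc : ∀ᵐ ω ∂P, Continuous fun t => Y t ω) :
    ∃ Z : Space d → Ω → ℝ, IsContinuousProcess Z k P ∧ ∀ᵐ ω ∂P, ∀ t, Y t ω = Z t ω := by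
  obtain ⟨B, hsub, hBm, hB0⟩ := exists_measurable_superset_of_null (ae_iff.1 hc)
  have hmem : ∀ᵐ ω ∂P, ω ∉ B := by simpa [ae_iff] using hB0
  have hae : ∀ᵐ ω ∂P, ∀ t, Y t ω = Bᶜ.indicator (Y t) ω := by
    filter_upwards [hmem] with ω hω t
    rw [Set.indicator_of_mem (by simpa using hω)]
  have hL : ∀ t, MemLp (Y t) 2 P := fun t => (hY.gaussian.hasGaussianLaw_eval t).memLp_two
  have hmul : ∀ s t, (fun ω => Y s ω * Y t ω) =ᵐ[P]
      fun ω => Bᶜ.indicator (Y s) ω * Bᶜ.indicator (Y t) ω := fun s t => by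
    filter_upwards [hae] with ω hω
    rw [hω s, hω t]
  refine ⟨fun t => Bᶜ.indicator (Y t), ⟨fun t => (hY.measurable t).indicator hBm.compl,
    fun ω => ?_, fun s t => ((hL s).integrable_mul (hL t)).congr (hmul s t), fun s t => ?_⟩, hae⟩
  · by_cases hω : ω ∈ B
    · simp only [Set.indicator_of_notMem (show ω ∉ Bᶜ by simpa using hω)]
      exact continuous_const
    · simp only [Set.indicator_of_mem (show ω ∈ Bᶜ from hω)]
      by_contra hn
      exact hω (hsub hn)
  · rw [← integral_congr_ae (hmul s t), ← hY.cov_eq s t, covariance_eq_sub (hL s) (hL t),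
      hY.mean_zero, zero_mul, sub_zero]
    rfl

variable {Y : Space d → Ω → ℝ} {k : Space d → ℝ}

lemma IsContinuousProcess.measurable_uncurry (hY : IsContinuousProcess Y k P) :
    Measurable (Function.uncurry Y) :=
  measurable_uncurry_of_continuous_of_measurable hY.continuous hY.measurable

lemma IsContinuousProcess.lintegral_sq (hY : IsContinuousProcess Y k P) (t : Space d) :
    ∫⁻ ω, ENNReal.ofReal (Y t ω ^ 2) ∂P = ENNReal.ofReal (k 0) := by
  have hi : Integrable (fun ω => Y t ω ^ 2) P := by simpa [sq] using hY.integrable_mul t t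
  rw [← ofReal_integral_eq_lintegral_ofReal hi (.of_forall fun ω => sq_nonneg _)]
  have := hY.integral_mul t t
  rw [sub_self] at this
  simp [sq, this]

lemma IsContinuousProcess.lintegral_sq_sum (hY : IsContinuousProcess Y k P) {ι : Type}
    [Fintype ι] (s : ι → Space d) (c : ι → ℝ) :
    ∫⁻ ω, ENNReal.ofReal ((∑ i, c i * Y (s i) ω) ^ 2) ∂P =
      ENNReal.ofReal (∑ i, ∑ j, c i * c j * k (s i - s j)) := by
  have hexp : (fun ω => (∑ i, c i * Y (s i) ω) ^ 2) =
      fun ω => ∑ i, ∑ j, c i * c j * (Y (s i) ω * Y (s j) ω) := by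
    ext ω
    rw [sq, Finset.sum_mul_sum]
    exact Finset.sum_congr rfl fun i _ => Finset.sum_congr rfl fun j _ => by ring
  have hij : ∀ i j, Integrable (fun ω => c i * c j * (Y (s i) ω * Y (s j) ω)) P :=
    fun i j => (hY.integrable_mul _ _).const_mul _
  have hi : Integrable (fun ω => (∑ i, c i * Y (s i) ω) ^ 2) P := by
    rw [hexp]
    exact integrable_finsetSum _ fun i _ => integrable_finsetSum _ fun j _ => hij i j
  rw [← ofReal_integral_eq_lintegral_ofReal hi (.of_forall fun ω => sq_nonneg _), hexp,
    integral_finsetSum _ fun i _ => integrable_finsetSum _ fun j _ => hij i j]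
  congr 1
  refine Finset.sum_congr rfl fun i _ => ?_
  rw [integral_finsetSum _ fun j _ => hij i j]
  refine Finset.sum_congr rfl fun j _ => ?_
  rw [integral_const_mul, hY.integral_mul]

/-- The mean squared prediction error at a point separated from the observations. -/
lemma IsContinuousProcess.le_lintegral_predictor_sub (hY : IsContinuousProcess Y k P) {c δ : ℝ}
    (hc : 0 < c)
    (hq : ∀ (ι : Type) [Fintype ι] (s : ι → Space d), Separated δ s → ∀ x : ι → ℝ,
      c * ∑ i, x i ^ 2 ≤ ∑ i, ∑ j, x i * x j * k (s i - s j))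
    {n : ℕ} (s : Fin n → Space d) (t : Space d)
    (hs : Separated δ fun i : Option (Fin n) => i.elim t s) :
    ENNReal.ofReal c ≤
      ∫⁻ ω, ENNReal.ofReal ((predictor k s (fun i => Y (s i) ω) t - Y t ω) ^ 2) ∂P := by
  let w : Fin n → ℝ := (fun j => k (s j - t)) ᵥ* (covMatrix k s)⁻¹
  -- The index `none` stands for `t`. Its coefficient `-1` alone makes the sum of squares at least
  -- 1, whatever the Kriging weights.
  let x : Option (Fin n) → ℝ := fun i => i.elim (-1) w
  have hlin : ∀ ω, predictor k s (fun i => Y (s i) ω) t - Y t ω =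
      ∑ i, x i * Y (i.elim t s) ω := by
    intro ω
    rw [predictor, Matrix.dotProduct_mulVec, Fintype.sum_option, dotProduct]
    simp only [x, w, Option.elim]
    ring
  simp_rw [hlin]
  rw [hY.lintegral_sq_sum]
  refine ENNReal.ofReal_le_ofReal (le_trans ?_ (hq _ _ hs x))
  rw [Fintype.sum_option]
  have : 0 ≤ ∑ i, x (some i) ^ 2 := Finset.sum_nonneg fun i _ => sq_nonneg _
  have h1 : x none ^ 2 = 1 := by simp [x]
  nlinarith

end Trajectory

/-! ### Measurability of the predictor -/

section Measurability
variable {Ω : Type*} [MeasurableSpace Ω]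

lemma measurable_matrix_det {n : ℕ} {M : Ω → Matrix (Fin n) (Fin n) ℝ}
    (hM : ∀ i j, Measurable fun ω => M ω i j) : Measurable fun ω => (M ω).det := by
  simp_rw [Matrix.det_apply']
  exact Finset.measurable_fun_sum _ fun σ _ =>
    (Finset.measurable_fun_prod _ fun i _ => hM _ _).const_mul _

/-- Cramer's formula `det⁻¹ • adjugate` remains valid at singular matrices, where both sides are 0.
-/
lemma measurable_matrix_inv {n : ℕ} {M : Ω → Matrix (Fin n) (Fin n) ℝ}
    (hM : ∀ i j, Measurable fun ω => M ω i j) (i j : Fin n) :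
    Measurable fun ω => (M ω)⁻¹ i j := by
  simp_rw [Matrix.inv_def, Matrix.smul_apply, Ring.inverse_eq_inv', Matrix.adjugate_apply,
    smul_eq_mul]
  refine (measurable_matrix_det hM).inv.mul (measurable_matrix_det fun k l => ?_)
  simp only [Matrix.updateRow_apply]
  split_ifs
  · exact measurable_const
  · exact hM k l

lemma measurable_predictor {d n : ℕ} {k : Space d → ℝ} (hk : Measurable k)
    {s : Ω → Fin n → Space d} (hs : ∀ i, Measurable fun ω => s ω i)
    {y : Ω → Fin n → ℝ} (hy : ∀ i, Measurable fun ω => y ω i)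
    {t : Ω → Space d} (ht : Measurable t) :
    Measurable fun ω => predictor k (s ω) (y ω) (t ω) := by
  simp_rw [predictor, dotProduct, Matrix.mulVec, dotProduct]
  refine Finset.measurable_fun_sum _ fun i _ => (hk.comp ((hs i).sub ht)).mul ?_
  refine Finset.measurable_fun_sum _ fun j _ => (measurable_matrix_inv (fun a b => ?_) i j).mul
    (hy j)
  exact hk.comp ((hs a).sub (hs b))

end Measurability

/-! ### Convergence in probability -/

/-- A product of a sequence converging to zero in measure with a sequence of bounded mean
converges to zero in measure. -/
lemma tendstoInMeasure_zero_of_le_mul {Ω E : Type*} [MeasurableSpace Ω] {μ : Measure Ω}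
    [NormedAddCommGroup E] {f : ℕ → Ω → ℝ} {θ : ℕ → Ω → E} {θ₀ : E} {Z : ℕ → Ω → ℝ} {A B : ℝ}
    (hA : 0 < A) (hB : 0 < B)
    (hf : ∀ᶠ n in atTop, ∀ᵐ ω ∂μ, |f n ω| ≤ A * ‖θ n ω - θ₀‖ * Z n ω)
    (hZm : ∀ n, Measurable (Z n))
    (hZ : ∀ᶠ n in atTop, ∫⁻ ω, ENNReal.ofReal (Z n ω) ∂μ ≤ ENNReal.ofReal B)
    (hθ : TendstoInMeasure μ θ atTop fun _ => θ₀) :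
    TendstoInMeasure μ f atTop fun _ => (0 : ℝ) := by
  rw [tendstoInMeasure_iff_norm] at hθ ⊢
  intro e he
  rw [ENNReal.tendsto_nhds_zero]
  intro κ hκ
  obtain ⟨κ', hκ'0, hκ'⟩ : ∃ κ' : ℝ, 0 < κ' ∧ ENNReal.ofReal κ' ≤ κ / 2 := by
    rcases eq_or_ne κ ⊤ with rfl | hne
    · exact ⟨1, one_pos, by simp [ENNReal.top_div]⟩
    · refine ⟨(κ / 2).toReal, ENNReal.toReal_pos (by simpa using hκ.ne') ?_, ?_⟩
      · exact (ENNReal.div_lt_top hne (by simp)).ne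
      · exact ENNReal.ofReal_toReal_le
  -- By Markov, `Z n` reaches `M` with probability at most `κ' ≤ κ / 2`; below `M`, a parameter
  -- error under `e / (A * M)` keeps the product under `e`.
  set M := B / κ' with hM
  have hM0 : 0 < M := by positivity
  have hsmall := (ENNReal.tendsto_nhds_zero.1 (hθ (e / (A * M)) (by positivity))) (κ / 2)
    (ENNReal.half_pos hκ.ne')
  filter_upwards [hf, hZ, hsmall] with n hfn hZn hθn
  have hmarkov : μ {ω | M ≤ Z n ω} ≤ κ / 2 := by
    have h1 := mul_meas_ge_le_lintegral (μ := μ) (hZm n).ennreal_ofReal (ENNReal.ofReal M)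
    have h2 : {ω | M ≤ Z n ω} ⊆ {ω | ENNReal.ofReal M ≤ ENNReal.ofReal (Z n ω)} :=
      fun ω hω => ENNReal.ofReal_le_ofReal hω
    have h3 : ENNReal.ofReal M * μ {ω | M ≤ Z n ω} ≤ ENNReal.ofReal B :=
      (mul_le_mul_right (measure_mono h2) _).trans (h1.trans hZn)
    have h4 : ENNReal.ofReal B = ENNReal.ofReal M * ENNReal.ofReal κ' := by
      rw [← ENNReal.ofReal_mul hM0.le, hM, div_mul_cancel₀ _ hκ'0.ne']
    rw [h4] at h3
    exact ((ENNReal.mul_le_mul_iff_right (by simpa using hM0) (by simp)).1 h3).trans hκ'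
  have hsub : {ω | e ≤ ‖f n ω - 0‖} ≤ᵐ[μ]
      ({ω | e / (A * M) ≤ ‖θ n ω - θ₀‖} ∪ {ω | M ≤ Z n ω} : Set Ω) := by
    filter_upwards [hfn] with ω hω h
    change e ≤ ‖f n ω - 0‖ at h
    change e / (A * M) ≤ ‖θ n ω - θ₀‖ ∨ M ≤ Z n ω
    by_contra! hcon
    rw [sub_zero, Real.norm_eq_abs] at h
    have h1 := hcon.1
    rw [lt_div_iff₀ (by positivity)] at h1
    have h2 : A * ‖θ n ω - θ₀‖ * Z n ω ≤ A * ‖θ n ω - θ₀‖ * M :=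
      mul_le_mul_of_nonneg_left hcon.2.le (by positivity)
    linarith
  calc μ {ω | e ≤ ‖f n ω - 0‖} ≤ μ ({ω | e / (A * M) ≤ ‖θ n ω - θ₀‖} ∪ {ω | M ≤ Z n ω}) :=
        measure_mono_ae hsub
    _ ≤ κ / 2 + κ / 2 := (measure_union_le _ _).trans (add_le_add hθn hmarkov)
    _ = κ := ENNReal.add_halves κ

/-! ### Expectations on the product space -/

section Product
variable {d : ℕ} {ΩX ΩY : Type*} [MeasurableSpace ΩX] [MeasurableSpace ΩY]
  {PX : Measure ΩX} {PY : Measure ΩY}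
  {X : ℕ → ΩX → Space d} {Y : Space d → ΩY → ℝ} {k : Space d → ℝ}

lemma measurable_obsPoints (v : ℕ → Fin d → ℕ) (ε : ℝ) (hX : ∀ i, Measurable (X i)) (n : ℕ)
    (i : Fin n) : Measurable fun ω => obsPoints v ε (fun i => X i ω) n i :=
  ((hX i).const_smul ε).const_add _

lemma IsContinuousProcess.measurable_obs (hY : IsContinuousProcess Y k PY)
    (v : ℕ → Fin d → ℕ) (ε : ℝ) (hX : ∀ i, Measurable (X i)) (n : ℕ) (i : Fin n) :
    Measurable fun ω : ΩX × ΩY => Y (obsPoints v ε (fun i => X i ω.1) n i) ω.2 :=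
  hY.measurable_uncurry.comp
    (((measurable_obsPoints v ε hX n i).comp measurable_fst).prodMk measurable_snd)

lemma IsContinuousProcess.measurable_energy (hY : IsContinuousProcess Y k PY)
    (v : ℕ → Fin d → ℕ) (ε : ℝ) (hX : ∀ i, Measurable (X i)) (n N : ℕ) :
    Measurable fun ω : ΩX × ΩY =>
      energy v ε n N (fun i => X i ω.1) (fun t => Y t ω.2) := by
  unfold energy
  refine Measurable.const_mul (Measurable.add ?_ ?_) _
  · exact Finset.measurable_fun_sum _ fun i _ => (hY.measurable_obs v ε hX n i).pow_const 2
  · refine StronglyMeasurable.measurable ?_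
    refine StronglyMeasurable.integral_prod_right
      (f := fun (ω : ΩX × ΩY) (t : Space d) => Y t ω.2 ^ 2) ?_
    refine Measurable.stronglyMeasurable ?_
    exact (hY.measurable_uncurry.comp
      (measurable_snd.prodMk (measurable_snd.comp measurable_fst))).pow_const 2

lemma IsContinuousProcess.measurable_error (hY : IsContinuousProcess Y k PY) (hk : Measurable k)
    (v : ℕ → Fin d → ℕ) (ε : ℝ) (hX : ∀ i, Measurable (X i)) (n : ℕ) :
    Measurable fun z : (ΩX × ΩY) × Space d =>
      (predictor k (obsPoints v ε (fun i => X i z.1.1) n)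
        (fun i => Y (obsPoints v ε (fun i => X i z.1.1) n i) z.1.2) z.2 - Y z.2 z.1.2) ^ 2 := by
  refine ((measurable_predictor hk (fun i => ?_) (fun i => ?_) measurable_snd).sub ?_).pow_const 2
  · exact (measurable_obsPoints v ε hX n i).comp (measurable_fst.comp measurable_fst)
  · exact (hY.measurable_obs v ε hX n i).comp measurable_fst
  · exact hY.measurable_uncurry.comp
      (measurable_snd.prodMk (measurable_snd.comp measurable_fst))

lemma IsContinuousProcess.measurable_predError (hY : IsContinuousProcess Y k PY)
    (hk : Measurable k) (v : ℕ → Fin d → ℕ) (ε : ℝ) (hX : ∀ i, Measurable (X i)) (n N : ℕ) :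
    Measurable fun ω : ΩX × ΩY =>
      predError v ε n N k (fun i => X i ω.1) (fun t => Y t ω.2) := by
  unfold predError
  refine Measurable.const_mul ?_ _
  exact (StronglyMeasurable.integral_prod_right' (hY.measurable_error hk v ε hX n).stronglyMeasurable
    (ν := volume.restrict (cube d N))).measurable

variable [IsProbabilityMeasure PX] [IsProbabilityMeasure PY]

/-- Integrating over `ΩY` first freezes the observation points, so each observation contributes `k
0`; and `n < (N + 1) ^ d ≤ (2 * N) ^ d` gives `n / N ^ d ≤ 2 ^ d`. -/
lemma IsContinuousProcess.lintegral_energy_le (hY : IsContinuousProcess Y k PY)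
    (v : ℕ → Fin d → ℕ) (ε : ℝ) (hX : ∀ i, Measurable (X i)) {n N : ℕ} (hN : 1 ≤ N)
    (hn : n < (N + 1) ^ d) :
    ∫⁻ ω : ΩX × ΩY, ENNReal.ofReal (energy v ε n N (fun i => X i ω.1) (fun t => Y t ω.2))
      ∂(PX.prod PY) ≤ ENNReal.ofReal ((2 ^ d + 1) * k 0) := by
  have hk0 : 0 ≤ k 0 := by
    have := hY.integral_mul 0 0
    rw [sub_self] at this
    rw [← this]
    exact integral_nonneg fun ω => mul_self_nonneg _
  have hN' : (0 : ℝ) < N := by exact_mod_cast hN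
  have hobs : ∀ i : Fin n, ∫⁻ ω : ΩX × ΩY,
      ENNReal.ofReal (Y (obsPoints v ε (fun i => X i ω.1) n i) ω.2 ^ 2) ∂(PX.prod PY) =
        ENNReal.ofReal (k 0) := by
    intro i
    rw [lintegral_prod _ ((hY.measurable_obs v ε hX n i).pow_const 2).ennreal_ofReal.aemeasurable]
    simp_rw [hY.lintegral_sq]
    simp
  have hmY : Measurable fun z : (ΩX × ΩY) × Space d => ENNReal.ofReal (Y z.2 z.1.2 ^ 2) :=
    ((hY.measurable_uncurry.comp
      (measurable_snd.prodMk (measurable_snd.comp measurable_fst))).pow_const 2).ennreal_ofReal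
  have hcube : ∫⁻ ω : ΩX × ΩY, ENNReal.ofReal (∫ t in cube d N, Y t ω.2 ^ 2) ∂(PX.prod PY) =
      ENNReal.ofReal (k 0) * (N : ENNReal) ^ d := by
    have h1 : ∀ ω : ΩX × ΩY, ENNReal.ofReal (∫ t in cube d N, Y t ω.2 ^ 2) =
        ∫⁻ t in cube d N, ENNReal.ofReal (Y t ω.2 ^ 2) := fun ω =>
      ofReal_integral_eq_lintegral_ofReal (integrableOn_cube ((hY.continuous ω.2).pow 2))
        (.of_forall fun t => sq_nonneg _)
    simp_rw [h1]
    rw [lintegral_lintegral_swap hmY.aemeasurable]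
    have h2 : ∀ t, ∫⁻ ω : ΩX × ΩY, ENNReal.ofReal (Y t ω.2 ^ 2) ∂(PX.prod PY) =
        ENNReal.ofReal (k 0) := fun t => by
      rw [← hY.lintegral_sq t]
      exact (measurePreserving_snd (μ := PX) (ν := PY)).lintegral_comp
        ((hY.measurable t).pow_const 2).ennreal_ofReal
    simp_rw [h2]
    rw [setLIntegral_const, volume_cube]
  have hsplit : ∀ ω : ΩX × ΩY,
      ENNReal.ofReal (energy v ε n N (fun i => X i ω.1) (fun t => Y t ω.2)) =
      ENNReal.ofReal (1 / (N : ℝ) ^ d) *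
        (∑ i : Fin n, ENNReal.ofReal (Y (obsPoints v ε (fun i => X i ω.1) n i) ω.2 ^ 2) +
          ENNReal.ofReal (∫ t in cube d N, Y t ω.2 ^ 2)) := by
    intro ω
    rw [energy, ENNReal.ofReal_mul (by positivity), ENNReal.ofReal_add
      (Finset.sum_nonneg fun i _ => sq_nonneg _) (integral_nonneg fun t => sq_nonneg _),
      ENNReal.ofReal_sum_of_nonneg fun i _ => sq_nonneg _]
  simp_rw [hsplit]
  have hms : Measurable fun ω : ΩX × ΩY =>
      ∑ i : Fin n, ENNReal.ofReal (Y (obsPoints v ε (fun i => X i ω.1) n i) ω.2 ^ 2) :=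
    Finset.measurable_fun_sum _ fun i _ =>
      ((hY.measurable_obs v ε hX n i).pow_const 2).ennreal_ofReal
  rw [lintegral_const_mul' _ _ ENNReal.ofReal_ne_top, lintegral_add_left hms,
    lintegral_finsetSum _ fun i _ => ((hY.measurable_obs v ε hX n i).pow_const 2).ennreal_ofReal,
    hcube, Finset.sum_congr rfl fun i _ => hobs i]
  have hNE : (N : ENNReal) ^ d = ENNReal.ofReal ((N : ℝ) ^ d) := by
    rw [ENNReal.ofReal_pow hN'.le, ENNReal.ofReal_natCast]
  rw [Finset.sum_const, Finset.card_univ, Fintype.card_fin, nsmul_eq_mul, hNE,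
    ← ENNReal.ofReal_natCast n, ← ENNReal.ofReal_mul (by positivity), ← ENNReal.ofReal_mul hk0,
    ← ENNReal.ofReal_add (by positivity) (by positivity), ← ENNReal.ofReal_mul (by positivity)]
  refine ENNReal.ofReal_le_ofReal ?_
  have hn2 : (n : ℝ) ≤ 2 ^ d * (N : ℝ) ^ d := by
    have : n ≤ (2 * N) ^ d := hn.le.trans (Nat.pow_le_pow_left (by omega) d)
    rw [← mul_pow]; exact_mod_cast this
  rw [one_div, inv_mul_le_iff₀ (by positivity)]
  nlinarith [mul_le_mul_of_nonneg_right hn2 hk0]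

end Product

section Expectation
variable {d : ℕ} {ΩX ΩY : Type*} [MeasurableSpace ΩX] [MeasurableSpace ΩY]
  {PX : Measure ΩX} {PY : Measure ΩY} [IsProbabilityMeasure PX] [IsProbabilityMeasure PY]
  {X : ℕ → ΩX → Space d} {Y : Space d → ΩY → ℝ} {k : Space d → ℝ}

/-- By Tonelli the mean error is the average over the cube of the pointwise mean squared error,
which is at least `c` on the test set, of volume `(N * 2 * gap ε) ^ d`. -/
lemma IsContinuousProcess.lintegral_predError_ge (hY : IsContinuousProcess Y k PY)
    (hk : Continuous k) (hd : 1 ≤ d) {v : ℕ → Fin d → ℕ} (hv : Function.Injective v) {ε : ℝ}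
    (hε₀ : 0 ≤ ε) (hε : ε < 1 / 2) (hX : ∀ i, Measurable (X i))
    (hXbox : ∀ᵐ ω ∂PX, ∀ i j, X i ω j ∈ Set.Icc (-1 : ℝ) 1) {c : ℝ} (hc : 0 < c)
    (hq : ∀ (ι : Type) [Fintype ι] (s : ι → Space d), Separated (gap ε) s → ∀ x : ι → ℝ,
      c * ∑ i, x i ^ 2 ≤ ∑ i, ∑ j, x i * x j * k (s i - s j))
    {n N : ℕ} (hN : 1 ≤ N) :
    ENNReal.ofReal (c * (2 * gap ε) ^ d) ≤
      ∫⁻ ω : ΩX × ΩY, ENNReal.ofReal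
        (predError v ε n N k (fun i => X i ω.1) (fun t => Y t ω.2)) ∂(PX.prod PY) := by
  have hN' : (0 : ℝ) < N := by exact_mod_cast hN
  have hm := (hY.measurable_error hk.measurable v ε hX n).ennreal_ofReal
  have h1 : ∀ ω : ΩX × ΩY, ENNReal.ofReal
      (predError v ε n N k (fun i => X i ω.1) (fun t => Y t ω.2)) =
      ENNReal.ofReal (1 / (N : ℝ) ^ d) * ∫⁻ t in cube d N, ENNReal.ofReal
        ((predictor k (obsPoints v ε (fun i => X i ω.1) n)
          (fun i => Y (obsPoints v ε (fun i => X i ω.1) n i) ω.2) t - Y t ω.2) ^ 2) := by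
    intro ω
    have hp := continuous_predictor hk (obsPoints v ε (fun i => X i ω.1) n)
      (fun i => Y (obsPoints v ε (fun i => X i ω.1) n i) ω.2)
    have hc := hY.continuous ω.2
    rw [predError, ENNReal.ofReal_mul (by positivity), ofReal_integral_eq_lintegral_ofReal
      (integrableOn_cube (by fun_prop)) (.of_forall fun t => sq_nonneg _)]
  simp_rw [h1]
  rw [lintegral_const_mul' _ _ ENNReal.ofReal_ne_top, lintegral_lintegral_swap hm.aemeasurable]
  have h2 : ∀ t ∈ testSet d N (gap ε), ENNReal.ofReal c ≤ ∫⁻ ω : ΩX × ΩY, ENNReal.ofReal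
        ((predictor k (obsPoints v ε (fun i => X i ω.1) n)
          (fun i => Y (obsPoints v ε (fun i => X i ω.1) n i) ω.2) t - Y t ω.2) ^ 2)
        ∂(PX.prod PY) := by
    intro t ht
    have hmt := hm.comp (measurable_prodMk_right (y := t))
    simp only [Function.comp_def] at hmt
    rw [lintegral_prod _ hmt.aemeasurable]
    calc ENNReal.ofReal c = ∫⁻ _ω, ENNReal.ofReal c ∂PX := by simp
      _ ≤ _ := by
        refine lintegral_mono_ae ?_
        filter_upwards [hXbox] with ω hω
        exact hY.le_lintegral_predictor_sub hc hq _ t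
          (separated_option_obsPoints hd hv hε₀ hε hω n ht)
  have hgap : gap ε ≤ 1 / 4 := by unfold gap; linarith
  have hgap0 := gap_pos hε
  refine le_trans ?_ (mul_le_mul_right (lintegral_mono_set (testSet_subset_cube d N hgap)) _)
  refine le_trans ?_ (mul_le_mul_right (setLIntegral_mono' (measurableSet_testSet d N _) h2) _)
  rw [setLIntegral_const, volume_testSet d N hgap, ← ENNReal.ofReal_natCast,
    ← ENNReal.ofReal_pow hN'.le, ← ENNReal.ofReal_pow (by positivity),
    ← ENNReal.ofReal_mul (by positivity), ← ENNReal.ofReal_mul hc.le,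
    ← ENNReal.ofReal_mul (by positivity)]
  refine ENNReal.ofReal_le_ofReal (le_of_eq ?_)
  field_simp

end Expectation

lemma ae_mem_Icc_of_map_eq {d : ℕ} {L : Measure (Space d)} (hL : IsPerturbationLaw L) {Ω : Type*}
    [MeasurableSpace Ω] {P : Measure Ω} {X : ℕ → Ω → Space d} (hX : ∀ i, Measurable (X i))
    (hlaw : ∀ i, P.map (X i) = L) : ∀ᵐ ω ∂P, ∀ i k, X i ω k ∈ Set.Icc (-1 : ℝ) 1 := by
  refine ae_all_iff.2 fun i => ?_
  have h : ∀ᵐ x ∂(P.map (X i)), ∀ k, x k ∈ Set.Icc (-1 : ℝ) 1 := by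
    rw [hlaw i]
    filter_upwards [L.support_mem_ae] with x hx
    exact hL.support_subset hx
  exact ae_of_ae_map (hX i).aemeasurable h

end Kriging

end

/-! ### Proof of the proposition -/

theorem mainTheorem10 {d p : ℕ} (hd : 1 ≤ d)
    -- the parametric model and the true parameter
    (a b : ℝ) (K : (Fin p → ℝ) → Kriging.Space d → ℝ)
    (hK : Kriging.RegularModel a b K)
    (hKcont : ∀ θ ∈ Kriging.paramSet p a b, ∀ i : Fin p,
      Continuous (fun t => Kriging.partialDeriv a b i (fun η => K η t) θ))
    (θ₀ : Fin p → ℝ) (hθ₀ : ∀ i, a < θ₀ i ∧ θ₀ i < b)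
    -- the randomly perturbed grid
    (v : ℕ → Fin d → ℕ) (hv : Kriging.IsGridEnumeration v)
    (ε : ℝ) (hε₀ : 0 ≤ ε) (hε : ε < 1 / 2)
    (L : Measure (Kriging.Space d)) (hL : Kriging.IsPerturbationLaw L)
    {ΩX : Type*} [MeasurableSpace ΩX] (PX : Measure ΩX) [IsProbabilityMeasure PX]
    (X : ℕ → ΩX → Kriging.Space d) (hXmeas : ∀ i, Measurable (X i))
    (hXindep : iIndepFun X PX) (hXlaw : ∀ i, PX.map (X i) = L)
    -- the Gaussian process, independent of the perturbations (product space)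
    {ΩY : Type*} [MeasurableSpace ΩY] (PY : Measure ΩY) [IsProbabilityMeasure PY]
    (Y : Kriging.Space d → ΩY → ℝ)
    (hY : Kriging.IsCenteredGaussianProcess Y (K θ₀) PY)
    (hYcont : ∀ᵐ ω ∂PY, Continuous (fun t => Y t ω))
    -- the side length of the prediction domain
    (N : ℕ → ℕ) (hN : ∀ n, 1 ≤ n → N n ^ d ≤ n ∧ n < (N n + 1) ^ d) :
    -- any consistent estimator has asymptotically no influence on the prediction error
    (∀ θhat : ℕ → ΩX × ΩY → (Fin p → ℝ),
      (∀ n, Measurable (θhat n)) →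
      (∀ n ω, θhat n ω ∈ Kriging.paramSet p a b) →
      TendstoInMeasure (PX.prod PY) θhat atTop (fun _ => θ₀) →
      TendstoInMeasure (PX.prod PY)
        (fun n ω =>
          |Kriging.predError v ε n (N n) (K θ₀) (fun i => X i ω.1) (fun t => Y t ω.2)
            - Kriging.predError v ε n (N n) (K (θhat n ω)) (fun i => X i ω.1)
                (fun t => Y t ω.2)|)
        atTop (fun _ => (0 : ℝ))) ∧
    -- the mean prediction error does not vanish
    (∃ A : ℝ, 0 < A ∧ ∀ n, 1 ≤ n →
      Integrable (fun ω : ΩX × ΩY =>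
        Kriging.predError v ε n (N n) (K θ₀) (fun i => X i ω.1) (fun t => Y t ω.2))
        (PX.prod PY) ∧
      A ≤ ∫ ω : ΩX × ΩY,
        Kriging.predError v ε n (N n) (K θ₀) (fun i => X i ω.1) (fun t => Y t ω.2)
        ∂(PX.prod PY)) := by
  have hθ₀' : θ₀ ∈ Kriging.paramSet p a b := fun i => ⟨(hθ₀ i).1.le, (hθ₀ i).2.le⟩
  have hgap := Kriging.gap_pos hε
  have hvinj := hv.injective hd
  have hKc := hK.continuous hθ₀'
  have hXbox := Kriging.ae_mem_Icc_of_map_eq hL hXmeas hXlaw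
  obtain ⟨Z, hZ, hYZ⟩ := hY.exists_isContinuousProcess hYcont
  obtain ⟨A, hA, hbd⟩ := hK.exists_predError_bounds hgap
  obtain ⟨c, hc, hq⟩ := hK.exists_quadraticForm_ge hgap
  have hN1 : ∀ n, 1 ≤ n → 1 ≤ N n := fun n hn => by
    by_contra h0
    have h := (hN n hn).2
    rw [show N n = 0 by omega, zero_add, one_pow] at h
    omega
  have hX' : ∀ᵐ ω : ΩX × ΩY ∂(PX.prod PY), ∀ i k, X i ω.1 k ∈ Set.Icc (-1 : ℝ) 1 :=
    Measure.quasiMeasurePreserving_fst.ae hXbox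
  have hY' : ∀ᵐ ω : ΩX × ΩY ∂(PX.prod PY), (fun t => Y t ω.2) = fun t => Z t ω.2 := by
    filter_upwards [Measure.quasiMeasurePreserving_snd.ae hYZ] with ω hω
    exact funext hω
  have hk0 : 0 ≤ K θ₀ 0 := by
    have h := hZ.integral_mul 0 0
    rw [sub_self] at h
    rw [← h]
    exact integral_nonneg fun ω => mul_self_nonneg _
  -- The added 1 makes the bound strictly positive, as the Markov argument requires.
  have henergy : ∀ n, 1 ≤ n → ∫⁻ ω : ΩX × ΩY, ENNReal.ofReal
      (Kriging.energy v ε n (N n) (fun i => X i ω.1) (fun t => Z t ω.2)) ∂(PX.prod PY) ≤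
      ENNReal.ofReal ((2 ^ d + 1) * K θ₀ 0 + 1) := fun n hn =>
    (hZ.lintegral_energy_le v ε hXmeas (hN1 n hn) (hN n hn).2).trans
      (ENNReal.ofReal_le_ofReal (by linarith))
  refine ⟨fun θhat _ hθhat hcons => ?_, c * (2 * Kriging.gap ε) ^ d, by positivity,
    fun n hn => ?_⟩
  · refine Kriging.tendstoInMeasure_zero_of_le_mul (B := (2 ^ d + 1) * K θ₀ 0 + 1) hA
      (by positivity) (.of_forall fun n => ?_)
      (fun n => hZ.measurable_energy v ε hXmeas n (N n))
      ((eventually_ge_atTop 1).mono henergy) hcons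
    filter_upwards [hX', hY'] with ω hx hy
    rw [hy, abs_abs, abs_sub_comm]
    -- The deterministic bound is applied at each `ω`, with the value `θhat n ω` as parameter.
    exact (hbd v ε n (N n) _ _ (Kriging.separated_obsPoints hvinj hε₀ hε hx n)
      (hZ.continuous ω.2)).2 _ (hθhat n ω) _ hθ₀'
  · have hcongr : (fun ω : ΩX × ΩY => Kriging.predError v ε n (N n) (K θ₀) (fun i => X i ω.1)
        (fun t => Z t ω.2)) =ᵐ[PX.prod PY] fun ω => Kriging.predError v ε n (N n) (K θ₀)
        (fun i => X i ω.1) (fun t => Y t ω.2) := by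
      filter_upwards [hY'] with ω hy
      rw [hy]
    have hEint : Integrable (fun ω : ΩX × ΩY => Kriging.energy v ε n (N n) (fun i => X i ω.1)
        (fun t => Z t ω.2)) (PX.prod PY) := by
      refine ⟨(hZ.measurable_energy v ε hXmeas n (N n)).aestronglyMeasurable, ?_⟩
      rw [hasFiniteIntegral_iff_ofReal (.of_forall fun ω => Kriging.energy_nonneg _ _ _ _ _ _)]
      exact (henergy n hn).trans_lt ENNReal.ofReal_lt_top
    have hint : Integrable (fun ω : ΩX × ΩY => Kriging.predError v ε n (N n) (K θ₀)
        (fun i => X i ω.1) (fun t => Z t ω.2)) (PX.prod PY) := by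
      refine (hEint.const_mul A).mono'
        (hZ.measurable_predError hKc.measurable v ε hXmeas n (N n)).aestronglyMeasurable ?_
      filter_upwards [hX'] with ω hx
      rw [Real.norm_of_nonneg (Kriging.predError_nonneg _ _ _ _ _ _ _)]
      exact (hbd v ε n (N n) _ _ (Kriging.separated_obsPoints hvinj hε₀ hε hx n)
        (hZ.continuous ω.2)).1 _ hθ₀'
    refine ⟨hint.congr hcongr, ?_⟩
    rw [← integral_congr_ae hcongr]
    have hge := hZ.lintegral_predError_ge hKc hd hvinj hε₀ hε hXmeas hXbox hc (hq θ₀ hθ₀')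
      (n := n) (hN1 n hn)
    rw [← ofReal_integral_eq_lintegral_ofReal hint
      (.of_forall fun ω => Kriging.predError_nonneg _ _ _ _ _ _ _)] at hge
    exact (ENNReal.ofReal_le_ofReal_iff
      (integral_nonneg fun ω => Kriging.predError_nonneg _ _ _ _ _ _ _)).1 hge
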